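/- **Setting.** Let $(\Omega,d)$ be a compact metric space with a non-atomic Borel probability measure $m$, and let $\mathcal R=\{R_\alpha\}_{\alpha\in J}$ be a family of subsets of $\Omega$ (the resonant sets), indexed by an infinite countable set $J$. Let $\beta:J\to\mathbb R^+$, $\alpha\mapsto\beta_\alpha$, be such that $\{\alpha\in J:\beta_\alpha\le K\}$ is finite for every $K$. Write $B(x,r)$ for the ball with centre $x$ and radius $r$, and $\Delta(A,\varepsilon)=\{x\in\Omega:\operatorname{dist}(x,A)<\varepsilon\}$ for the $\varepsilon$-neighbourhood of $A$. An *approximating function* is a decreasing function $\psi:\mathbb R^+\to\mathbb R^+$; put $$\Lambda(\psi)=\{x\in\Omega: x\in\Delta(R_\alpha,\psi(\beta_\alpha))\text{ for infinitely many }\alpha\in J\}.$$ Let $l=(l_n)$ and $u=(u_n)$ be positive increasing (not necessarily strictly) sequences with $l_n<u_n$ and $l_n\to\infty$, and let $\rho:\mathbb R^+\to\mathbb R^+$ be a function with $\rho(r)\to0$ as $r\to\infty$. Put $\Delta_l^u(\rho,n)=\bigcup_{\alpha:\ l_n<\beta_\alpha\le u_n}\Delta(R_\alpha,\rho(u_n))$.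 *Condition (M2)* with exponent $\delta>0$: there are constants $a,b,r_o>0$ with $a\,r^\delta\le m(B(x,r))\le b\,r^\delta$ for all $x\in\Omega$ and $0<r\le r_o$. $(\mathcal R,\beta)$ is a *locally $m$-ubiquitous system relative to $(\rho,l,u)$*, with common dimension $\gamma$, if * there are constants $\kappa,r_0>0$ such that for every ball $B$ with centre in $\Omega$ and radius at most $r_0$ there is $n_o(B)$ with $m(B\cap\Delta_l^u(\rho,n))\ge\kappa\, m(B)$ for all $n\ge n_o(B)$; and * (*intersection conditions*) $0\le\gamma\le\dim\Omega$ (Hausdorff dimension), and there are constants $c_1,c_2>0$ such that for all sufficiently large $n$, all $\alpha\in J$ with $\beta_\alpha\le u_n$, all $c\in R_\alpha$ and all $0<\lambda\le\rho(u_n)$, $$m\big(B(c,\tfrac12\rho(u_n))\cap\Delta(R_\alpha,\lambda)\big)\ \ge\ c_1\, m(B(c,\lambda))\Big(\frac{\rho(u_n)}{\lambda}\Big)^{\gamma},$$ $$m\big(B\cap B(c,3\rho(u_n))\cap\Delta(R_\alpha,3\lambda)\big)\ \le\ c_2\, m(B(c,\lambda))\Big(\frac{r(B)}{\lambda}\Big)^{\gamma}$$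 for every ball $B$ centred at a point of a resonant set with radius $r(B)\le3\rho(u_n)$. A function $h$ is *$u$-regular* if there is a constant $0<\lambda<1$ with $h(u_{n+1})\le\lambda\,h(u_n)$ for all sufficiently large $n$. **Corollary 4.** Suppose that $m$ satisfies (M2) with exponent $\delta$, that $(\mathcal R,\beta)$ is a locally $m$-ubiquitous system relative to $(\rho,l,u)$ with common dimension $\gamma$, and that $\psi$ is an approximating function. Let $s\ge0$ with $\gamma<s<\delta$, let $g(r)=\psi(r)^{s-\gamma}\rho(r)^{\gamma-\delta}$ and let $G=\limsup_{n\to\infty}g(u_n)\in[0,\infty]$. Let $\mathcal H^s$ denote $s$-dimensional Hausdorff measure. 1. If $G=0$ and either $\psi$ or $\rho$ is $u$-regular, then $\mathcal H^s(\Lambda(\psi))=\infty$ whenever $\sum_{n=1}^\infty g(u_n)=\infty$. 2. If $0<G\le\infty$, then $\mathcal H^s(\Lambda(\psi))=\infty$. -/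

import Mathlib

open MeasureTheory Filter Topology
open scoped ENNReal

namespace Ubiquity

/-- Condition (M2): the measure of every ball of small radius, centred at a point of the space, is
comparable to the `δ`-th power of its radius. -/
def MeasureM2 {Ω : Type*} [MetricSpace Ω] [MeasurableSpace Ω] (m : Measure Ω) (δ : ℝ) : Prop :=
  0 < δ ∧ ∃ a b r₀ : ℝ, 0 < a ∧ 0 < b ∧ 0 < r₀ ∧
    ∀ (x : Ω) (r : ℝ), 0 < r → r ≤ r₀ →
      ENNReal.ofReal (a * r ^ δ) ≤ m (Metric.ball x r) ∧
        m (Metric.ball x r) ≤ ENNReal.ofReal (b * r ^ δ)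

/-- A weight on the index set of the resonant sets: a positive function such that only finitely
many indices have weight below any given bound. -/
def IsWeight {J : Type*} (β : J → ℝ) : Prop :=
  (∀ α, 0 < β α) ∧ ∀ K : ℝ, {α | β α ≤ K}.Finite

/-- `l` and `u` are a lower and an upper sequence: positive, increasing, `l n < u n`, `l n → ∞`. -/
structure IsLowerUpper (l u : ℕ → ℝ) : Prop where
  lower_pos : ∀ n, 0 < l n
  lower_mono : Monotone l
  upper_mono : Monotone u
  lt : ∀ n, l n < u n
  tendsto : Tendsto l atTop atTop

/-- Approximating functions `ℝ⁺ → ℝ⁺`: positive and decreasing on the positive half line. -/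
def IsApproximating (ψ : ℝ → ℝ) : Prop :=
  (∀ r, 0 < r → 0 < ψ r) ∧ AntitoneOn ψ (Set.Ioi 0)

/-- Ubiquitous functions `ℝ⁺ → ℝ⁺`: positive on the positive half line, tending to `0` at `∞`. -/
def IsUbiquityFunction (ρ : ℝ → ℝ) : Prop :=
  (∀ r, 0 < r → 0 < ρ r) ∧ Tendsto ρ atTop (𝓝 0)

/-- The limsup set `Λ(ψ)`: the points lying in `Δ(R α, ψ (β α))` for infinitely many `α`, where
`Δ(A, ε)` is the open `ε`-neighbourhood of `A`. -/
def limsupSet {Ω J : Type*} [MetricSpace Ω] (R : J → Set Ω) (β : J → ℝ) (ψ : ℝ → ℝ) : Set Ω :=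
  {x | {α | x ∈ Metric.thickening (ψ (β α)) (R α)}.Infinite}

/-- `Δ_l^u(ρ, n)`: the union of the `ρ (u n)`-neighbourhoods of the resonant sets `R α` with
`l n < β α ≤ u n`. -/
def ubiquityUnion {Ω J : Type*} [MetricSpace Ω] (R : J → Set Ω) (β : J → ℝ) (ρ : ℝ → ℝ)
    (l u : ℕ → ℝ) (n : ℕ) : Set Ω :=
  ⋃ α ∈ {α | l n < β α ∧ β α ≤ u n}, Metric.thickening (ρ (u n)) (R α)

/-- The intersection conditions with common dimension `γ`. The constants `c₁`, `c₂` and the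
threshold on `n` do not depend on `α`, `c`, `t` or the ball `B = Metric.ball y r`, which is centred
on an arbitrary resonant set `R α'`. -/
def IntersectionConditions {Ω J : Type*} [MetricSpace Ω] [MeasurableSpace Ω] (m : Measure Ω)
    (R : J → Set Ω) (β : J → ℝ) (ρ : ℝ → ℝ) (u : ℕ → ℝ) (γ : ℝ) : Prop :=
  0 ≤ γ ∧ ENNReal.ofReal γ ≤ dimH (Set.univ : Set Ω) ∧
  ∃ c₁ c₂ : ℝ, 0 < c₁ ∧ 0 < c₂ ∧ ∀ᶠ n in atTop,
    ∀ α, β α ≤ u n → ∀ c ∈ R α, ∀ t : ℝ, 0 < t → t ≤ ρ (u n) →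
      ENNReal.ofReal (c₁ * (ρ (u n) / t) ^ γ) * m (Metric.ball c t) ≤
          m (Metric.ball c (1 / 2 * ρ (u n)) ∩ Metric.thickening t (R α)) ∧
        ∀ α', ∀ y ∈ R α', ∀ r : ℝ, 0 < r → r ≤ 3 * ρ (u n) →
          m (Metric.ball y r ∩ Metric.ball c (3 * ρ (u n)) ∩ Metric.thickening (3 * t) (R α)) ≤
            ENNReal.ofReal (c₂ * (r / t) ^ γ) * m (Metric.ball c t)

/-- `(R, β)` is a local `m`-ubiquitous system relative to `(ρ, l, u)`, with common dimension `γ`.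
The constant `κ` is uniform, while the threshold on `n` may depend on the ball. -/
def IsLocallyUbiquitous {Ω J : Type*} [MetricSpace Ω] [MeasurableSpace Ω] (m : Measure Ω)
    (R : J → Set Ω) (β : J → ℝ) (ρ : ℝ → ℝ) (l u : ℕ → ℝ) (γ : ℝ) : Prop :=
  (∃ κ r₀ : ℝ, 0 < κ ∧ 0 < r₀ ∧ ∀ (x : Ω) (r : ℝ), 0 < r → r ≤ r₀ → ∀ᶠ n in atTop,
    ENNReal.ofReal κ * m (Metric.ball x r) ≤ m (Metric.ball x r ∩ ubiquityUnion R β ρ l u n)) ∧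
  IntersectionConditions m R β ρ u γ

/-- `h` is `u`-regular. -/
def IsRegular (h : ℝ → ℝ) (u : ℕ → ℝ) : Prop :=
  ∃ lam : ℝ, 0 < lam ∧ lam < 1 ∧ ∀ᶠ n in atTop, h (u (n + 1)) ≤ lam * h (u n)

/-- The function `g(r) = ψ(r)^(s - γ) ρ(r)^(γ - δ)`. -/
noncomputable def gFun (ψ ρ : ℝ → ℝ) (s γ δ : ℝ) (r : ℝ) : ℝ :=
  ψ r ^ (s - γ) * ρ r ^ (γ - δ)

/-- `G = limsup g(u n)`, an element of `[0, ∞]`. -/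
noncomputable def limsupG (ψ ρ : ℝ → ℝ) (u : ℕ → ℝ) (s γ δ : ℝ) : ℝ≥0∞ :=
  limsup (fun n => ENNReal.ofReal (gFun ψ ρ s γ δ (u n))) atTop

end Ubiquity

/-!
Let `q i` be radii below `ψ (u (φ i))`. The `i`-th level measure pushes the `m`-mass of
well-separated balls of radius `ρ (u (φ i))` onto the `q i`-neighbourhoods of the resonant sets
inside them. By ubiquity it looks like `m` at every fixed scale once `i` is large, and the
intersection conditions bound its ball masses by a constant times `t ^ s / g i`, with a gain away
from the scale `q i`, where `g i = q i ^ (s - γ) * ρ (u (φ i)) ^ (γ - δ)`.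

Average many levels with weights proportional to `g i`. If the `q i` decay geometrically, each ball
feels only boundedly many levels, so that `∑ g i = ∞` makes the average satisfy
`ν (B (x, t)) ≤ ε t ^ s` with `ε` as small as desired. Starting from `m`, such averages are used
over and over again to move the mass by tiny amounts into neighbourhoods of high level. The weak
limit is a probability measure carried by the limsup set with `ν (B (x, t)) ≤ ε t ^ s` for small
`t`, and the mass distribution principle gives Hausdorff measure at least of order `1 / ε`, for
every `ε`.

Radii with geometric decay and divergent `∑ g i` are a subsequence of `ψ (u n) / 2` if `G = 0`, and
radii making `g i` constant if `G > 0`.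
-/

namespace Ubiquity

open Metric
open scoped NNReal MeasureTheory

section Perturbation

variable {Ω : Type*} [PseudoMetricSpace Ω] [MeasurableSpace Ω] {μ ν ξ : Measure Ω} {σ τ : ℝ}

/-- `ν` arises from `μ` by moving mass over distances less than `τ`. Only open sets are tested, so
that the relation passes to weak limits. -/
def IsPerturbation (τ : ℝ) (μ ν : Measure Ω) : Prop :=
  ∀ G : Set Ω, IsOpen G → ν G ≤ μ (thickening τ G)

namespace IsPerturbation

theorem refl (hτ : 0 < τ) (μ : Measure Ω) : IsPerturbation τ μ μ :=
  fun G _ => measure_mono (self_subset_thickening hτ G)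

theorem trans (h₁ : IsPerturbation τ μ ν) (h₂ : IsPerturbation σ ν ξ) :
    IsPerturbation (τ + σ) μ ξ :=
  fun G hG => (h₂ G hG).trans <| (h₁ _ isOpen_thickening).trans <|
    measure_mono (thickening_thickening_subset τ σ G)

theorem mono (h : IsPerturbation τ μ ν) (hτσ : τ ≤ σ) : IsPerturbation σ μ ν :=
  fun G hG => (h G hG).trans (measure_mono (thickening_mono hτσ G))

theorem measure_ball_le (h : IsPerturbation τ μ ν) (x : Ω) (t : ℝ) :
    ν (ball x t) ≤ μ (ball x (t + τ)) := by
  refine (h _ isOpen_ball).trans (measure_mono fun y hy => ?_)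
  obtain ⟨z, hz, hyz⟩ := mem_thickening_iff.1 hy
  rw [mem_ball] at hz ⊢
  linarith [dist_triangle y z x]

theorem support_subset [HereditarilyLindelofSpace Ω] (h : IsPerturbation τ μ ν) :
    ν.support ⊆ cthickening τ μ.support := by
  refine Measure.support_subset_of_isClosed isClosed_cthickening ?_
  refine le_antisymm ((h _ isClosed_cthickening.isOpen_compl).trans ?_) zero_le
  refine (measure_mono fun y hy hyμ => ?_).trans Measure.measure_compl_support.le
  obtain ⟨z, hz, hyz⟩ := mem_thickening_iff.1 hy
  refine hz (thickening_subset_cthickening τ _ (mem_thickening_iff.2 ⟨y, hyμ, ?_⟩))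
  rwa [dist_comm]

theorem of_halving {μ : ℕ → Measure Ω} {e : ℕ → ℝ} (he : ∀ k, 0 < e k)
    (hhalf : ∀ k, e (k + 1) ≤ e k / 2)
    (h : ∀ k, IsPerturbation (e k / 2) (μ k) (μ (k + 1))) {k j : ℕ} (hkj : k ≤ j) :
    IsPerturbation (e k) (μ k) (μ j) := by
  induction hkj using Nat.decreasingInduction with
  | self => exact refl (he j) _
  | of_succ k _ ih => exact ((h k).trans ih).mono (by linarith [hhalf k])

end IsPerturbation

end Perturbation

section WeakLimit

variable {Ω : Type*} [MetricSpace Ω] [MeasurableSpace Ω] [BorelSpace Ω]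

theorem isPerturbation_of_tendsto {ι : Type*} {F : Filter ι} [F.NeBot] {τ : ℝ} {μ : Measure Ω}
    {ξ : ι → ProbabilityMeasure Ω} {ν : ProbabilityMeasure Ω} (hlim : Tendsto ξ F (𝓝 ν))
    (h : ∀ᶠ i in F, IsPerturbation τ μ (ξ i)) : IsPerturbation τ μ ν := fun G hG =>
  (ProbabilityMeasure.le_liminf_measure_open_of_tendsto hlim hG).trans <|
    liminf_le_of_frequently_le' (h.mono fun _ hi => hi G hG).frequently

theorem exists_isPerturbation_limit [CompactSpace Ω] {μ : ℕ → ProbabilityMeasure Ω} {e : ℕ → ℝ}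
    (h : ∀ k j, k ≤ j → IsPerturbation (e k) (μ k : Measure Ω) (μ j)) :
    ∃ ν : ProbabilityMeasure Ω, ∀ k, IsPerturbation (e k) (μ k : Measure Ω) ν := by
  obtain ⟨ν, -, φ, hφ, hlim⟩ := isCompact_univ.tendsto_subseq fun n => Set.mem_univ (μ n)
  exact ⟨ν, fun k => isPerturbation_of_tendsto hlim <|
    (hφ.tendsto_atTop.eventually_ge_atTop k).mono fun j hj => h k _ hj⟩

end WeakLimit

section MassDistribution

variable {Ω : Type*} [MetricSpace Ω] [MeasurableSpace Ω] {ν : Measure Ω} {s C t₀ : ℝ}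

/-- The Frostman condition with exponent `s` and constant `C`, at scales up to `t₀`. -/
def IsFrostman (ν : Measure Ω) (s C t₀ : ℝ) : Prop :=
  ∀ (x : Ω) (t : ℝ), 0 < t → t ≤ t₀ → ν (ball x t) ≤ ENNReal.ofReal (C * t ^ s)

theorem IsFrostman.measure_le_ediam_rpow (h : IsFrostman ν s C t₀) (hs : 0 ≤ s) {E : Set Ω}
    (hE : ediam E < ENNReal.ofReal t₀) : ν E ≤ ENNReal.ofReal C * ediam E ^ s := by
  rcases E.eq_empty_or_nonempty with rfl | ⟨x, hx⟩
  · simp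
  have hfin : ediam E ≠ ∞ := (hE.trans_le le_top).ne
  set d := (ediam E).toReal
  have hdE : ediam E = ENNReal.ofReal d := (ENNReal.ofReal_toReal hfin).symm
  have hdt : d < t₀ := (ENNReal.lt_ofReal_iff_toReal_lt hfin).1 hE
  have hball : ∀ t, d < t → t ≤ t₀ → ν E ≤ ENNReal.ofReal (C * t ^ s) := fun t ht htt₀ => by
    refine (measure_mono fun y hy => ?_).trans (h x t (ENNReal.toReal_nonneg.trans_lt ht) htt₀)
    rw [mem_ball, dist_edist]
    exact (ENNReal.toReal_mono hfin (edist_le_ediam_of_mem hy hx)).trans_lt ht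
  have hlim : Tendsto (fun t => ENNReal.ofReal (C * t ^ s)) (𝓝[>] d)
      (𝓝 (ENNReal.ofReal (C * d ^ s))) :=
    (ENNReal.tendsto_ofReal (((Real.continuousAt_rpow_const d s (Or.inr hs)).tendsto).const_mul
      C)).mono_left nhdsWithin_le_nhds
  rw [hdE, ENNReal.ofReal_rpow_of_nonneg ENNReal.toReal_nonneg hs,
    ← ENNReal.ofReal_mul' (Real.rpow_nonneg ENNReal.toReal_nonneg s)]
  refine ge_of_tendsto hlim ?_
  filter_upwards [Ioc_mem_nhdsGT hdt] with t ht using hball t ht.1 ht.2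

theorem IsFrostman.le_hausdorffMeasure [BorelSpace Ω] (h : IsFrostman ν s C t₀) (hs : 0 ≤ s)
    (ht₀ : 0 < t₀) : (ENNReal.ofReal C)⁻¹ • ν ≤ μH[s] := by
  refine Measure.le_hausdorffMeasure s _ (ENNReal.ofReal (t₀ / 2))
    (ENNReal.ofReal_pos.2 (half_pos ht₀)) fun E hE => ?_
  rw [Measure.smul_apply, smul_eq_mul, mul_comm, ← div_eq_mul_inv]
  refine ENNReal.div_le_of_le_mul' (h.measure_le_ediam_rpow hs (hE.trans_lt ?_))
  exact (ENNReal.ofReal_lt_ofReal_iff ht₀).2 (half_lt_self ht₀)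

theorem hausdorffMeasure_eq_top_of_forall_isFrostman [BorelSpace Ω] {Λ : Set Ω} (hs : 0 ≤ s)
    (h : ∀ ε > 0, ∃ ν : ProbabilityMeasure Ω, ∃ t₀ > 0,
      IsFrostman (ν : Measure Ω) s ε t₀ ∧ (ν : Measure Ω) Λᶜ = 0) : μH[s] Λ = ∞ := by
  refine ENNReal.eq_top_of_forall_nnreal_le fun c => ?_
  obtain ⟨ν, t₀, ht₀, hν, hΛ⟩ := h (c + 1 : ℝ)⁻¹ (by positivity)
  have hmass : (ν : Measure Ω) Λ = 1 := (measure_congr (ae_eq_univ.2 hΛ)).trans measure_univ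
  have hle := hν.le_hausdorffMeasure hs ht₀ Λ
  rw [Measure.smul_apply, hmass, smul_eq_mul, mul_one,
    ENNReal.ofReal_inv_of_pos (by positivity), inv_inv] at hle
  refine le_trans ?_ hle
  rw [← ENNReal.ofReal_coe_nnreal]
  exact ENNReal.ofReal_le_ofReal (by simp)

end MassDistribution

section Refinement

variable {Ω : Type*} [MetricSpace Ω] [CompactSpace Ω] [MeasurableSpace Ω]

theorem exists_refining_sequence {𝓜 : Set (ProbabilityMeasure Ω)} (h𝓜 : 𝓜.Nonempty)
    {U : ℕ → Set Ω} (hU : ∀ N, IsOpen (U N)) {s ε : ℝ}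
    (h : ∀ μ ∈ 𝓜, ∃ r > 0, ∀ τ > 0, ∀ N, ∃ μ' ∈ 𝓜, (μ' : Measure Ω).support ⊆ U N ∧
      IsFrostman (μ' : Measure Ω) s ε r ∧ IsPerturbation τ (μ : Measure Ω) μ') :
    ∃ (μ : ℕ → ProbabilityMeasure Ω) (e : ℕ → ℝ), (∀ k, 0 < e k) ∧ (∀ k, e (k + 1) ≤ e k / 2) ∧
      (∀ k, IsPerturbation (e k / 2) (μ k : Measure Ω) (μ (k + 1))) ∧
      (∀ k, cthickening (e (k + 1)) (μ (k + 1) : Measure Ω).support ⊆ U k) ∧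
      ∀ k, IsFrostman (μ (k + 1) : Measure Ω) s ε (2 * e k) := by
  choose! r hr hnext using h
  let Admissible : Set (ProbabilityMeasure Ω × ℝ) := {p | p.1 ∈ 𝓜 ∧ 0 < p.2 ∧ 2 * p.2 ≤ r p.1}
  have hstep : ∀ (k : ℕ) (p : Admissible), ∃ p' : Admissible, p'.1.2 ≤ p.1.2 / 2 ∧
      IsPerturbation (p.1.2 / 2) (p.1.1 : Measure Ω) p'.1.1 ∧
      cthickening p'.1.2 (p'.1.1 : Measure Ω).support ⊆ U k ∧
      IsFrostman (p'.1.1 : Measure Ω) s ε (2 * p.1.2) := by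
    rintro k ⟨⟨μ, e⟩, hμ, he, her⟩
    obtain ⟨μ', hμ', hsupp, hball, hpert⟩ := hnext μ hμ (e / 2) (half_pos he) k
    obtain ⟨χ, hχ, hχU⟩ :=
      Measure.isClosed_support.isCompact.exists_cthickening_subset_open (hU k) hsupp
    have hr' := hr μ' hμ'
    refine ⟨⟨⟨μ', e / 2 ⊓ χ ⊓ r μ' / 2⟩, hμ', by positivity, ?_⟩, ?_, hpert, ?_,
      fun x t ht hte => hball x t ht (hte.trans her)⟩
    · linarith [inf_le_right (a := e / 2 ⊓ χ) (b := r μ' / 2)]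
    · exact inf_le_left.trans inf_le_left
    · exact (cthickening_mono (inf_le_left.trans inf_le_right) _).trans hχU
  choose next hhalf hpert hsupp hball using hstep
  obtain ⟨μ₀, hμ₀⟩ := h𝓜
  let σ : ℕ → Admissible := fun k => k.rec
    ⟨(μ₀, r μ₀ / 2), hμ₀, half_pos (hr μ₀ hμ₀), (mul_div_cancel₀ _ two_ne_zero).le⟩ next
  exact ⟨fun k => (σ k).1.1, fun k => (σ k).1.2, fun k => (σ k).2.2.1, fun k => hhalf k (σ k),
    fun k => hpert k (σ k), fun k => hsupp k (σ k), fun k => hball k (σ k)⟩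

theorem exists_lt_le_of_halving {e : ℕ → ℝ} (hhalf : ∀ k, e (k + 1) ≤ e k / 2) {t : ℝ} (ht : 0 < t)
    (hte : t ≤ e 0) : ∃ k, e (k + 1) < t ∧ t ≤ e k := by
  have hdecay : ∀ k, e k ≤ (1 / 2) ^ k * e 0 := fun k => by
    induction k with
    | zero => simp
    | succ k ih => rw [pow_succ]; linarith [hhalf k]
  have hex : ∃ k, e k < t := by
    obtain ⟨k, hk⟩ := exists_pow_lt_of_lt_one (div_pos ht (ht.trans_le hte)) one_half_lt_one
    exact ⟨k, (hdecay k).trans_lt ((lt_div_iff₀ (ht.trans_le hte)).1 hk)⟩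
  obtain ⟨k, hk⟩ := Nat.exists_eq_succ_of_ne_zero
    (fun h0 : Nat.find hex = 0 => (h0 ▸ Nat.find_spec hex).not_ge hte)
  exact ⟨k, Nat.succ_eq_add_one k ▸ hk ▸ Nat.find_spec hex,
    not_lt.1 (Nat.find_min hex (hk ▸ k.lt_succ_self))⟩

-- For `e (k + 1) < t ≤ e k`, the limit measure of a ball of radius `t` is at most the `k + 1`-st
-- measure of the concentric ball of radius `2 * t`.
theorem hausdorffMeasure_eq_top_of_refining [BorelSpace Ω]
    {𝓜 : Set (ProbabilityMeasure Ω)} (h𝓜 : 𝓜.Nonempty) {U : ℕ → Set Ω} (hU : ∀ N, IsOpen (U N))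
    {s : ℝ} (hs : 0 ≤ s)
    (h : ∀ ε > 0, ∀ μ ∈ 𝓜, ∃ r > 0, ∀ τ > 0, ∀ N, ∃ μ' ∈ 𝓜, (μ' : Measure Ω).support ⊆ U N ∧
      IsFrostman (μ' : Measure Ω) s ε r ∧ IsPerturbation τ (μ : Measure Ω) μ') :
    μH[s] (⋂ N, U N) = ∞ := by
  refine hausdorffMeasure_eq_top_of_forall_isFrostman hs fun ε hε => ?_
  obtain ⟨μ, e, he, hhalf, hpert, hsupp, hball⟩ :=
    exists_refining_sequence h𝓜 hU (h (ε / 2 ^ s) (by positivity))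
  obtain ⟨ν, hν⟩ := exists_isPerturbation_limit fun k j => IsPerturbation.of_halving he hhalf hpert
  refine ⟨ν, e 0, he 0, fun x t ht hte => ?_, ?_⟩
  · obtain ⟨k, hlt, hle⟩ := exists_lt_le_of_halving hhalf ht hte
    calc (ν : Measure Ω) (ball x t)
        ≤ (μ (k + 1) : Measure Ω) (ball x (t + e (k + 1))) := (hν (k + 1)).measure_ball_le x t
      _ ≤ (μ (k + 1) : Measure Ω) (ball x (2 * t)) := measure_mono (ball_subset_ball (by linarith))
      _ ≤ ENNReal.ofReal (ε / 2 ^ s * (2 * t) ^ s) :=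
          hball k x (2 * t) (by positivity) (by linarith)
      _ = ENNReal.ofReal (ε * t ^ s) := by
          rw [Real.mul_rpow zero_le_two ht.le, ← mul_assoc, div_mul_cancel₀ _ (by positivity)]
  · rw [Set.compl_iInter]
    refine measure_iUnion_null fun k => measure_mono_null (Set.compl_subset_compl.2 ?_)
      Measure.measure_compl_support
    exact (hν (k + 1)).support_subset.trans (hsupp k)

end Refinement

section Net

theorem exists_separated_net {Ω : Type*} [PseudoMetricSpace Ω] {P : Set Ω} (hP : TotallyBounded P)
    {r : ℝ} (hr : 0 < r) :
    ∃ (n : ℕ) (c : Fin n → Ω), (∀ i, c i ∈ P) ∧ (Pairwise fun i j => r < dist (c i) (c j)) ∧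
      ∀ y ∈ P, ∃ i, dist y (c i) ≤ r := by
  lift r to ℝ≥0 using hr.le
  have hr₂ : r / 2 ≠ 0 := (half_pos (NNReal.coe_pos.1 hr)).ne'
  obtain ⟨N, -, hNfin, hN⟩ := exists_finite_isCover_of_totallyBounded hr₂ hP
  have hpack : packingNumber r P ≠ ⊤ := by
    refine ne_top_of_le_ne_top (Set.encard_ne_top_iff.2 hNfin) ?_
    calc packingNumber r P = packingNumber (2 * (r / 2)) P := by rw [mul_div_cancel₀ r two_ne_zero]
      _ ≤ externalCoveringNumber (r / 2) P := packingNumber_two_mul_le_externalCoveringNumber _ _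
      _ ≤ N.encard := hN.externalCoveringNumber_le_encard
  obtain ⟨n, c, hc, hrange⟩ := (Set.encard_ne_top_iff.1 <|
    (encard_maximalSeparatedSet hpack).trans_ne hpack).fin_param
  have hmem : ∀ i, c i ∈ maximalSeparatedSet r P := fun i => hrange ▸ Set.mem_range_self i
  refine ⟨n, c, fun i => maximalSeparatedSet_subset (hmem i), fun i j hij => ?_, fun y hy => ?_⟩
  · have hsep : (r : ℝ≥0∞) < edist (c i) (c j) :=
      isSeparated_maximalSeparatedSet (hmem i) (hmem j) (hc.ne hij)
    rwa [edist_nndist, ENNReal.coe_lt_coe] at hsep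
  · obtain ⟨z, hz, hyz⟩ := isCover_maximalSeparatedSet hpack hy
    obtain ⟨i, rfl⟩ := hrange ▸ hz
    exact ⟨i, edist_le_coe.1 hyz⟩

end Net

section Spread

variable {Ω ι : Type*} [MeasurableSpace Ω] [Fintype ι] {ν : Measure Ω} {A : ι → Set Ω}
  {w : ι → ℝ≥0∞}

/-- The measure of mass `w i` on each `A i`, distributed inside `A i` proportionally to `ν`. -/
noncomputable def spread (ν : Measure Ω) (A : ι → Set Ω) (w : ι → ℝ≥0∞) : Measure Ω :=
  ∑ i, w i • ProbabilityTheory.cond ν (A i)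

theorem spread_apply (ν : Measure Ω) (A : ι → Set Ω) (w : ι → ℝ≥0∞) (E : Set Ω) :
    spread ν A w E = ∑ i, w i * ProbabilityTheory.cond ν (A i) E := by
  simp [spread, Measure.finsetSum_apply]

open Classical in
theorem spread_apply_le (hA : ∀ i, MeasurableSet (A i)) (w : ι → ℝ≥0∞) (E : Set Ω) :
    spread ν A w E ≤ ∑ i with (A i ∩ E).Nonempty, w i := by
  rw [spread_apply, Finset.sum_filter]
  refine Finset.sum_le_sum fun i _ => ?_
  split_ifs with h
  · exact mul_le_of_le_one_right' prob_le_one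
  · rw [ProbabilityTheory.cond_apply (hA i), Set.not_nonempty_iff_eq_empty.1 h]
    simp

theorem sum_le_spread_apply [IsFiniteMeasure ν] (hw : ∀ i, ν (A i) = 0 → w i = 0) {s : Finset ι}
    {E : Set Ω} (hs : ∀ i ∈ s, A i ⊆ E) : ∑ i ∈ s, w i ≤ spread ν A w E := by
  rw [spread_apply]
  refine (Finset.sum_le_sum fun i hi => ?_).trans
    (Finset.sum_le_sum_of_subset (Finset.subset_univ s))
  by_cases h : ν (A i) = 0
  · simp [hw i h]
  · refine le_mul_of_one_le_right' ?_
    rw [← ProbabilityTheory.cond_apply_self h (measure_ne_top ν _)]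
    exact measure_mono (hs i hi)

theorem spread_univ [IsFiniteMeasure ν] (hA : ∀ i, MeasurableSet (A i))
    (hw : ∀ i, ν (A i) = 0 → w i = 0) : spread ν A w Set.univ = ∑ i, w i := by
  classical
  exact le_antisymm ((spread_apply_le hA w _).trans
    (Finset.sum_le_sum_of_subset (Finset.subset_univ _)))
    (sum_le_spread_apply hw fun i _ => Set.subset_univ _)

theorem spread_le_smul_restrict (hA : ∀ i, MeasurableSet (A i))
    (hdisj : Pairwise (Function.onFun Disjoint A)) {D : ℝ≥0∞} (hw : ∀ i, w i ≤ D * ν (A i)) :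
    spread ν A w ≤ D • ν.restrict (⋃ i, A i) := by
  rw [Measure.restrict_iUnion hdisj hA, Measure.sum_fintype, Finset.smul_sum]
  refine Finset.sum_le_sum fun i _ => ?_
  rw [ProbabilityTheory.cond, smul_smul, ← div_eq_mul_inv]
  gcongr
  exact ENNReal.div_le_of_le_mul (hw i)

end Spread

section Transport

variable {Ω : Type*} [PseudoMetricSpace Ω] [MeasurableSpace Ω] [OpensMeasurableSpace Ω]

theorem exists_isPerturbation_le_smul {μ : ProbabilityMeasure Ω} {ν m : Measure Ω}
    [IsFiniteMeasure ν] {M K : ℝ≥0∞} (hμ : (μ : Measure Ω) ≤ M • m) {n : ℕ} {c : Fin n → Ω} {r : ℝ}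
    (hsep : Pairwise fun i j => 2 * r < dist (c i) (c j)) (hcov : ∀ y, ∃ i, dist y (c i) < 3 * r)
    (hK : ∀ i, m (ball (c i) (3 * r)) ≤ K * ν (ball (c i) r)) :
    ∃ μ' : ProbabilityMeasure Ω, (μ' : Measure Ω) ≤ (M * K) • ν ∧
      IsPerturbation (4 * r) (μ : Measure Ω) μ' := by
  classical
  set A : Fin n → Set Ω := fun i => ball (c i) r
  set Q : Fin n → Set Ω := disjointed fun i => ball (c i) (3 * r)
  have hA : ∀ i, MeasurableSet (A i) := fun i => measurableSet_ball
  have hQ : ∀ i, MeasurableSet (Q i) := fun i =>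
    disjointedRec (fun _ _ ht => ht.diff measurableSet_ball) measurableSet_ball
  have hQsum : ∀ s : Finset (Fin n),
      ∑ i ∈ s, (μ : Measure Ω) (Q i) = (μ : Measure Ω) (⋃ i ∈ s, Q i) :=
    fun s => (measure_biUnion_finset (fun i _ j _ hij => disjoint_disjointed _ hij)
      fun i _ => hQ i).symm
  have hw : ∀ i, (μ : Measure Ω) (Q i) ≤ M * K * ν (A i) := fun i => by
    calc (μ : Measure Ω) (Q i) ≤ M * m (ball (c i) (3 * r)) :=
          (measure_mono (disjointed_subset _ i)).trans (hμ _)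
      _ ≤ M * K * ν (A i) := by rw [mul_assoc]; gcongr; exact hK i
  have hmass : spread ν A (fun i => (μ : Measure Ω) (Q i)) Set.univ = 1 := by
    rw [spread_univ hA fun i hi => le_antisymm ((hw i).trans (by simp [hi])) zero_le, hQsum]
    have : ⋃ i ∈ Finset.univ, Q i = Set.univ := by
      simp only [Finset.mem_univ, Set.iUnion_true, Q, iUnion_disjointed]
      exact Set.eq_univ_of_forall fun y => Set.mem_iUnion.2 (hcov y)
    rw [this, measure_univ]
  refine ⟨⟨_, ⟨hmass⟩⟩, ?_, fun G _ => ?_⟩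
  · refine (spread_le_smul_restrict hA (fun i j hij => ball_disjoint_ball ?_) hw).trans ?_
    · linarith [hsep hij]
    · gcongr
      exact Measure.restrict_le_self
  · refine (spread_apply_le hA _ G).trans ?_
    rw [hQsum]
    refine measure_mono (Set.iUnion₂_subset fun i hi y hy => ?_)
    obtain ⟨z, hzA, hzG⟩ := (Finset.mem_filter.1 hi).2
    have hyc : dist y (c i) < 3 * r := disjointed_subset _ i hy
    have hzc : dist z (c i) < r := hzA
    exact mem_thickening_iff.2 ⟨z, hzG, by linarith [dist_triangle_right y z (c i)]⟩

end Transport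

section GeometricDecay

theorem sum_range_min_inv_le {x : ℕ → ℝ} (hx : ∀ i, 0 < x i) {η : ℝ} (hη : η < 1)
    (hstep : ∀ i, x (i + 1) ≤ η * x i) (n : ℕ) :
    ∑ i ∈ Finset.range n, min (x i) (x i)⁻¹ ≤ 2 / (1 - η) := by
  have hη0 : 0 < η := pos_of_mul_pos_left ((hx 1).trans_le (hstep 0)) (hx 0).le
  let Φ : ℕ → ℝ := fun i => min (x i) 1 - min (η * (x i)⁻¹) 1
  have hΦ : ∀ i, (1 - η) * min (x i) (x i)⁻¹ ≤ Φ i - Φ (i + 1) := fun i => by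
    have hle : x (i + 1) ≤ x i := (hstep i).trans (mul_le_of_le_one_left (hx i).le hη.le)
    have hinv : (x i)⁻¹ ≤ η * (x (i + 1))⁻¹ := by
      rw [← div_eq_mul_inv, inv_le_comm₀ (hx i) (div_pos hη0 (hx _)), inv_div,
        div_le_iff₀' hη0]
      exact hstep i
    have hη_inv : η * (x i)⁻¹ ≤ (x i)⁻¹ := mul_le_of_le_one_left (inv_pos.2 (hx i)).le hη.le
    rcases le_total (x i) 1 with h | h
    · have hmin : min (η * (x i)⁻¹) 1 ≤ min (η * (x (i + 1))⁻¹) 1 :=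
        min_le_min_right 1 (hη_inv.trans hinv)
      calc (1 - η) * min (x i) (x i)⁻¹ ≤ (1 - η) * x i := by
            gcongr
            exact min_le_left _ _
        _ ≤ min (x i) 1 - min (x (i + 1)) 1 := by
            rw [min_eq_left h]
            linarith [hstep i, min_le_left (x (i + 1)) 1]
        _ ≤ Φ i - Φ (i + 1) := by linarith
    · have hx1 : (x i)⁻¹ ≤ 1 := inv_le_one_of_one_le₀ h
      calc (1 - η) * min (x i) (x i)⁻¹ ≤ (1 - η) * (x i)⁻¹ := by
            gcongr
            exact min_le_right _ _
        _ ≤ min (η * (x (i + 1))⁻¹) 1 - min (η * (x i)⁻¹) 1 := by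
            linarith [le_min hinv hx1, min_le_left (η * (x i)⁻¹) 1]
        _ ≤ Φ i - Φ (i + 1) := by linarith [min_le_min_right 1 hle]
  rw [le_div_iff₀' (sub_pos.2 hη), Finset.mul_sum]
  calc ∑ i ∈ Finset.range n, (1 - η) * min (x i) (x i)⁻¹ ≤ Φ 0 - Φ n :=
        (Finset.sum_le_sum fun i _ => hΦ i).trans_eq (Finset.sum_range_sub' Φ n)
    _ ≤ 2 := by
        have hpos : ∀ i, 0 < min (x i) 1 ∧ 0 < min (η * (x i)⁻¹) 1 := fun i =>
          ⟨lt_min (hx i) one_pos, lt_min (mul_pos hη0 (inv_pos.2 (hx i))) one_pos⟩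
        linarith [min_le_right (x 0) 1, (hpos 0).2, (hpos n).1, min_le_right (η * (x n)⁻¹) 1]

theorem sum_range_min_div_rpow_le {q : ℕ → ℝ} (hq : ∀ i, 0 < q i) {θ : ℝ} (hθ : θ < 1)
    (hstep : ∀ i, q (i + 1) ≤ θ * q i) {e : ℝ} (he : 0 < e) {t : ℝ} (ht : 0 < t) (n : ℕ) :
    ∑ i ∈ Finset.range n, min (t / q i) (q i / t) ^ e ≤ 2 / (1 - θ ^ e) := by
  have hθ0 : 0 < θ := pos_of_mul_pos_left ((hq 1).trans_le (hstep 0)) (hq 0).le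
  have hmin : ∀ i,
      min (t / q i) (q i / t) ^ e = min ((q i / t) ^ e) ((q i / t) ^ e)⁻¹ := fun i => by
    have hqt : 0 < q i / t := div_pos (hq i) ht
    rw [← Real.inv_rpow hqt.le, inv_div, min_comm]
    exact (Real.monotoneOn_rpow_Ici_of_exponent_nonneg he.le).map_min hqt.le (div_pos ht (hq i)).le
  simp only [hmin]
  refine sum_range_min_inv_le (fun i => Real.rpow_pos_of_pos (div_pos (hq i) ht) e)
    (Real.rpow_lt_one hθ0.le hθ he) (fun i => ?_) n
  rw [← Real.mul_rpow hθ0.le (div_pos (hq i) ht).le, ← mul_div_assoc]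
  exact Real.rpow_le_rpow (div_pos (hq _) ht).le (div_le_div_of_nonneg_right (hstep i) ht.le) he.le

theorem exists_lt_sum_Ico_of_not_summable {g : ℕ → ℝ} (hg : ∀ i, 0 ≤ g i) (hsum : ¬ Summable g)
    (C : ℝ) (N : ℕ) : ∃ n, C < ∑ i ∈ Finset.Ico N n, g i := by
  have hlim := (not_summable_iff_tendsto_nat_atTop_of_nonneg hg).1 hsum
  obtain ⟨n, hn, hNn⟩ := ((hlim.eventually_gt_atTop (C + ∑ i ∈ Finset.range N, g i)).and
    (eventually_ge_atTop N)).exists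
  exact ⟨n, by rw [Finset.sum_Ico_eq_sub g hNn]; linarith⟩

end GeometricDecay

section WeightedAverage

variable {Ω : Type*} [MeasurableSpace Ω] {F : Finset ℕ} {g : ℕ → ℝ} {ν : ℕ → Measure Ω}

/-- The average of the measures `ν i`, `i ∈ F`, with weights proportional to `g i`. -/
noncomputable def weightedAverage (F : Finset ℕ) (g : ℕ → ℝ) (ν : ℕ → Measure Ω) : Measure Ω :=
  ∑ i ∈ F, ENNReal.ofReal (g i / ∑ j ∈ F, g j) • ν i

theorem weightedAverage_apply (F : Finset ℕ) (g : ℕ → ℝ) (ν : ℕ → Measure Ω) (E : Set Ω) :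
    weightedAverage F g ν E = ∑ i ∈ F, ENNReal.ofReal (g i / ∑ j ∈ F, g j) * ν i E := by
  simp [weightedAverage, Measure.finsetSum_apply]

theorem sum_div_sum_eq_one (hF : 0 < ∑ j ∈ F, g j) : ∑ i ∈ F, g i / ∑ j ∈ F, g j = 1 := by
  rw [← Finset.sum_div, div_self hF.ne']

theorem le_mul_weightedAverage_apply (hg : ∀ i, 0 ≤ g i) (hF : 0 < ∑ j ∈ F, g j) {a K : ℝ≥0∞}
    {E : Set Ω} (h : ∀ i ∈ F, a ≤ K * ν i E) : a ≤ K * weightedAverage F g ν E := by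
  calc a = ∑ i ∈ F, ENNReal.ofReal (g i / ∑ j ∈ F, g j) * a := by
        rw [← Finset.sum_mul, ← ENNReal.ofReal_sum_of_nonneg fun i _ => div_nonneg (hg i) hF.le,
          sum_div_sum_eq_one hF, ENNReal.ofReal_one, one_mul]
    _ ≤ ∑ i ∈ F, ENNReal.ofReal (g i / ∑ j ∈ F, g j) * (K * ν i E) :=
        Finset.sum_le_sum fun i hi => mul_le_mul_right (h i hi) _
    _ = K * weightedAverage F g ν E := by
        simp only [weightedAverage_apply, Finset.mul_sum, mul_left_comm]

theorem weightedAverage_apply_le (hg : ∀ i, 0 < g i) (hF : 0 < ∑ j ∈ F, g j) {A B : ℝ} {a : ℕ → ℝ}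
    {E : Set Ω} (hA : 0 ≤ A) (ha : ∀ i, 0 ≤ a i) (hB : 0 ≤ B)
    (h : ∀ i ∈ F, ν i E ≤ ENNReal.ofReal (A * (g i)⁻¹ * a i + B)) :
    weightedAverage F g ν E ≤ ENNReal.ofReal (A / (∑ j ∈ F, g j) * ∑ i ∈ F, a i + B) := by
  set Γ := ∑ j ∈ F, g j
  have hterm : ∀ i, ENNReal.ofReal (g i / Γ) * ENNReal.ofReal (A * (g i)⁻¹ * a i + B) =
      ENNReal.ofReal (A / Γ * a i + g i / Γ * B) := fun i => by
    have hgi := hg i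
    rw [← ENNReal.ofReal_mul (by positivity)]
    congr 1
    field_simp
  have hnonneg : ∀ i ∈ F, 0 ≤ A / Γ * a i + g i / Γ * B := fun i _ =>
    add_nonneg (mul_nonneg (by positivity) (ha i)) (mul_nonneg (div_nonneg (hg i).le hF.le) hB)
  calc weightedAverage F g ν E
      ≤ ∑ i ∈ F, ENNReal.ofReal (g i / Γ) * ENNReal.ofReal (A * (g i)⁻¹ * a i + B) := by
        rw [weightedAverage_apply]
        gcongr with i hi
        exact h i hi
    _ = ENNReal.ofReal (A / Γ * ∑ i ∈ F, a i + B) := by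
        simp only [hterm]
        rw [← ENNReal.ofReal_sum_of_nonneg hnonneg, Finset.sum_add_distrib, ← Finset.mul_sum,
          ← Finset.sum_mul, sum_div_sum_eq_one hF, one_mul]

theorem support_weightedAverage_subset [TopologicalSpace Ω] [HereditarilyLindelofSpace Ω]
    (F : Finset ℕ) (g : ℕ → ℝ) (ν : ℕ → Measure Ω) :
    (weightedAverage F g ν).support ⊆ ⋃ i ∈ F, (ν i).support := by
  refine Measure.support_subset_of_isClosed
    (isClosed_biUnion_finset fun i _ => Measure.isClosed_support) ?_
  rw [mem_ae_iff, weightedAverage_apply]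
  refine Finset.sum_eq_zero fun i hi => ?_
  have hnull : ν i (⋃ j ∈ F, (ν j).support)ᶜ = 0 :=
    measure_mono_null (Set.compl_subset_compl.2 (Set.subset_iUnion₂_of_subset i hi subset_rfl))
      Measure.measure_compl_support
  rw [hnull, mul_zero]

end WeightedAverage

section BoundedDensity

variable {Ω : Type*} [MeasurableSpace Ω] {m μ ν : Measure Ω}

/-- `μ` has a bounded density with respect to `m`. Refinement starts from such measures and does not
lead out of their class. -/
def HasBoundedDensity (μ m : Measure Ω) : Prop := ∃ M : ℝ≥0, μ ≤ M • m

theorem HasBoundedDensity.trans (hμ : HasBoundedDensity μ ν) (hν : HasBoundedDensity ν m) :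
    HasBoundedDensity μ m := by
  obtain ⟨M, hM⟩ := hμ
  obtain ⟨K, hK⟩ := hν
  exact ⟨M * K, by rw [mul_smul]; exact hM.trans (by gcongr)⟩

theorem HasBoundedDensity.weightedAverage {ν : ℕ → Measure Ω}
    (h : ∀ i, HasBoundedDensity (ν i) m) (F : Finset ℕ) (g : ℕ → ℝ) :
    HasBoundedDensity (weightedAverage F g ν) m := by
  choose M hM using h
  refine ⟨∑ i ∈ F, (g i / ∑ j ∈ F, g j).toNNReal * M i, ?_⟩
  rw [Finset.sum_smul]
  refine Finset.sum_le_sum fun i _ => ?_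
  rw [mul_smul]
  exact fun E => mul_le_mul_right (hM i E) _

theorem HasBoundedDensity.isFiniteMeasure [IsFiniteMeasure m] (h : HasBoundedDensity μ m) :
    IsFiniteMeasure μ :=
  let ⟨M, hM⟩ := h
  isFiniteMeasure_of_le (M • m) hM

end BoundedDensity

section LevelFamily

variable {Ω : Type*} [MetricSpace Ω] [MeasurableSpace Ω] {m : Measure Ω} {s δ : ℝ} {g q : ℕ → ℝ}
  {O : ℕ → Set Ω} {ν : ℕ → Measure Ω}

/-- Measures `ν i` carried by `O i` which look like `m` at scales that are fixed while `i` grows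
(`eventually_charge`), and which satisfy the Frostman condition with exponent `s` with a constant of
order `1 / g i` that improves geometrically away from the scale `q i` (`ball_le`). -/
structure IsLevelFamily (m : Measure Ω) (s δ : ℝ) (g q : ℕ → ℝ) (O : ℕ → Set Ω)
    (ν : ℕ → Measure Ω) : Prop where
  support_subset : ∀ i, (ν i).support ⊆ O i
  hasBoundedDensity : ∀ i, HasBoundedDensity (ν i) m
  ball_le : ∃ e > (0 : ℝ), ∃ K₁ K₂ : ℝ≥0, ∃ t₀ > 0, ∀ i x t, 0 < t → t ≤ t₀ → ν i (ball x t) ≤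
    ENNReal.ofReal (K₁ * (g i)⁻¹ * t ^ s * min (t / q i) (q i / t) ^ e + K₂ * t ^ δ)
  eventually_charge : ∃ K₃ : ℝ≥0, ∃ t₀ > 0, ∀ x r, 0 < r → r ≤ t₀ →
    ∀ᶠ i in atTop, m (ball x (3 * r)) ≤ K₃ * ν i (ball x r)

-- Only boundedly many levels matter at each scale, whereas `∑ g i = ∞` makes each of them weigh
-- arbitrarily little.
theorem exists_weightedAverage_ball_le {θ e K₁ K₂ t₀ : ℝ} (hq : ∀ i, 0 < q i) (hθ : θ < 1)
    (hstep : ∀ i, q (i + 1) ≤ θ * q i) (hg : ∀ i, 0 < g i) (hsum : ¬ Summable g) (he : 0 < e)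
    (hK₁ : 0 ≤ K₁) (hK₂ : 0 ≤ K₂)
    (hball : ∀ i x t, 0 < t → t ≤ t₀ → ν i (ball x t) ≤
      ENNReal.ofReal (K₁ * (g i)⁻¹ * t ^ s * min (t / q i) (q i / t) ^ e + K₂ * t ^ δ))
    {ε : ℝ} (hε : 0 < ε) (N : ℕ) :
    ∃ n, 0 < ∑ i ∈ Finset.Ico N n, g i ∧ ∀ x t, 0 < t → t ≤ t₀ →
      weightedAverage (Finset.Ico N n) g ν (ball x t) ≤
        ENNReal.ofReal (ε * t ^ s + K₂ * t ^ δ) := by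
  have hθ0 : 0 < θ := pos_of_mul_pos_left ((hq 1).trans_le (hstep 0)) (hq 0).le
  set C := 2 / (1 - θ ^ e)
  have hC : 0 < C := div_pos two_pos (sub_pos.2 (Real.rpow_lt_one hθ0.le hθ he))
  obtain ⟨n, hn⟩ := exists_lt_sum_Ico_of_not_summable (fun i => (hg i).le) hsum (K₁ * C / ε) N
  set Γ := ∑ i ∈ Finset.Ico N n, g i
  have hΓ : 0 < Γ := lt_of_le_of_lt (by positivity) hn
  refine ⟨n, hΓ, fun x t ht htt₀ => ?_⟩
  have hmin : ∀ i, 0 ≤ min (t / q i) (q i / t) ^ e := fun i =>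
    Real.rpow_nonneg (le_min (div_pos ht (hq i)).le (div_pos (hq i) ht).le) e
  have hsum_min : ∑ i ∈ Finset.Ico N n, min (t / q i) (q i / t) ^ e ≤ C := by
    refine (Finset.sum_le_sum_of_subset_of_nonneg (fun i hi => ?_) fun i _ _ => hmin i).trans
      (sum_range_min_div_rpow_le hq hθ hstep he ht n)
    exact Finset.mem_range.2 (Finset.mem_Ico.1 hi).2
  refine (weightedAverage_apply_le (A := K₁ * t ^ s) (B := K₂ * t ^ δ) hg hΓ (by positivity) hmin
    (by positivity) fun i _ => (hball i x t ht htt₀).trans_eq (by rw [mul_right_comm K₁])).trans ?_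
  refine ENNReal.ofReal_le_ofReal (add_le_add_left ?_ _)
  calc K₁ * t ^ s / Γ * ∑ i ∈ Finset.Ico N n, min (t / q i) (q i / t) ^ e
      ≤ K₁ * t ^ s / Γ * C := by gcongr
    _ = K₁ * C / Γ * t ^ s := by ring
    _ ≤ ε * t ^ s := by
      gcongr
      exact ((div_lt_comm₀ hε hΓ).1 hn).le

end LevelFamily

section Absorption

variable {Ω : Type*} [MetricSpace Ω] [MeasurableSpace Ω] {s δ ε : ℝ}

theorem exists_forall_mul_add_rpow_le {L : ℝ} (hL : 0 ≤ L) (K : ℝ) (hsδ : s < δ) (hε : 0 < ε) :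
    ∃ ε' > 0, ∃ r > 0, ∀ t, 0 < t → t ≤ r → L * (ε' * t ^ s + K * t ^ δ) ≤ ε * t ^ s := by
  have hlim : Tendsto (fun t : ℝ => L * K * t ^ (δ - s)) (𝓝 0) (𝓝 0) := by
    have h := ((Real.continuousAt_rpow_const 0 (δ - s)
      (Or.inr (sub_pos.2 hsδ).le)).tendsto).const_mul (L * K)
    rwa [Real.zero_rpow (sub_pos.2 hsδ).ne', mul_zero] at h
  obtain ⟨r, hr, hsmall⟩ :=
    Metric.nhds_basis_closedBall.eventually_iff.1 (hlim.eventually_le_const (half_pos hε))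
  refine ⟨ε / 2 / (L + 1), by positivity, r, hr, fun t ht htr => ?_⟩
  have hfirst : L * (ε / 2 / (L + 1)) ≤ ε / 2 := by
    rw [mul_div_left_comm]
    exact mul_le_of_le_one_right (half_pos hε).le (div_le_one_of_le₀ (by linarith) (by linarith))
  have hsecond : L * K * t ^ (δ - s) ≤ ε / 2 :=
    hsmall (by rwa [mem_closedBall, Real.dist_0_eq_abs, abs_of_pos ht])
  calc L * (ε / 2 / (L + 1) * t ^ s + K * t ^ δ)
      = (L * (ε / 2 / (L + 1)) + L * K * t ^ (δ - s)) * t ^ s := by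
        rw [← sub_add_cancel δ s, Real.rpow_add ht, add_sub_cancel_right]
        ring
    _ ≤ ε * t ^ s := by
        gcongr
        linarith

theorem exists_isFrostman_of_le_smul (L : ℝ≥0)
    (K : ℝ) {t₁ : ℝ} (ht₁ : 0 < t₁) (hsδ : s < δ) (hε : 0 < ε) :
    ∃ ε' > 0, ∃ r > 0, ∀ μ ξ : Measure Ω, μ ≤ L • ξ →
      (∀ x t, 0 < t → t ≤ t₁ → ξ (ball x t) ≤ ENNReal.ofReal (ε' * t ^ s + K * t ^ δ)) →
      IsFrostman μ s ε r := by
  obtain ⟨ε', hε', r, hr, habsorb⟩ := exists_forall_mul_add_rpow_le L.coe_nonneg K hsδ hε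
  refine ⟨ε', hε', min t₁ r, lt_min ht₁ hr, fun μ ξ hμ hξ x t ht htr => ?_⟩
  calc μ (ball x t) ≤ L * ξ (ball x t) := hμ _
    _ ≤ L * ENNReal.ofReal (ε' * t ^ s + K * t ^ δ) := by
        gcongr
        exact hξ x t ht (htr.trans (min_le_left _ _))
    _ ≤ ENNReal.ofReal (ε * t ^ s) := by
        rw [← ENNReal.ofReal_coe_nnreal, ← ENNReal.ofReal_mul L.coe_nonneg]
        exact ENNReal.ofReal_le_ofReal (habsorb t ht (htr.trans (min_le_right _ _)))

end Absorption

section LevelFamilyRefinement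

variable {Ω : Type*} [MetricSpace Ω] [CompactSpace Ω] [MeasurableSpace Ω] [BorelSpace Ω]
  {m : Measure Ω} {s δ θ ε : ℝ} {g q : ℕ → ℝ} {O : ℕ → Set Ω} {ν : ℕ → Measure Ω}

namespace IsLevelFamily

theorem exists_refinement [IsFiniteMeasure m] (hν : IsLevelFamily m s δ g q O ν)
    (hq : ∀ i, 0 < q i) (hθ : θ < 1) (hstep : ∀ i, q (i + 1) ≤ θ * q i) (hg : ∀ i, 0 < g i)
    (hsum : ¬ Summable g) (hsδ : s < δ) (hε : 0 < ε) {μ : ProbabilityMeasure Ω}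
    (hμ : HasBoundedDensity (μ : Measure Ω) m) :
    ∃ r > 0, ∀ τ > 0, ∀ N, ∃ μ' : ProbabilityMeasure Ω, HasBoundedDensity (μ' : Measure Ω) m ∧
      (μ' : Measure Ω).support ⊆ ⋃ i ≥ N, O i ∧ IsFrostman (μ' : Measure Ω) s ε r ∧
      IsPerturbation τ (μ : Measure Ω) μ' := by
  obtain ⟨M, hM⟩ := hμ
  obtain ⟨e, he, K₁, K₂, t₁, ht₁, hball⟩ := hν.ball_le
  obtain ⟨K₃, t₂, ht₂, hcharge⟩ := hν.eventually_charge
  obtain ⟨ε', hε', r₀, hr₀, hFrostman⟩ :=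
    exists_isFrostman_of_le_smul (Ω := Ω) (M * K₃) K₂ ht₁ hsδ hε
  refine ⟨r₀, hr₀, fun τ hτ N => ?_⟩
  set r := min t₂ (τ / 4)
  have hr : 0 < r := by positivity
  obtain ⟨k, c, -, hsep, hcov⟩ :=
    exists_separated_net (isCompact_univ (X := Ω)).totallyBounded (mul_pos two_pos hr)
  obtain ⟨N', hN'⟩ := eventually_atTop.1 <|
    eventually_all.2 fun j => hcharge (c j) r hr (min_le_left _ _)
  obtain ⟨n, hn, hξ⟩ := exists_weightedAverage_ball_le hq hθ hstep hg hsum he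
    K₁.coe_nonneg K₂.coe_nonneg hball hε' (max N N')
  set ξ := weightedAverage (Finset.Ico (max N N') n) g ν
  have hξm : HasBoundedDensity ξ m := HasBoundedDensity.weightedAverage hν.hasBoundedDensity _ _
  have := hξm.isFiniteMeasure
  obtain ⟨μ', hμ', hpert⟩ := exists_isPerturbation_le_smul (ν := ξ) hM hsep
    (fun y => (hcov y trivial).imp fun j hj => by linarith)
    (fun j => le_mul_weightedAverage_apply (fun i => (hg i).le) hn fun i hi =>
      hN' i ((le_max_right _ _).trans (Finset.mem_Ico.1 hi).1) j)
  have hμ'ξ : (μ' : Measure Ω) ≤ (M * K₃) • ξ := hμ'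
  refine ⟨μ', HasBoundedDensity.trans ⟨_, hμ'ξ⟩ hξm, ?_, hFrostman _ _ hμ'ξ hξ,
    hpert.mono (by linarith [min_le_right t₂ (τ / 4)])⟩
  refine ((Measure.absolutelyContinuous_of_le_smul hμ').support_mono.trans
    (support_weightedAverage_subset _ _ _)).trans (Set.iUnion₂_subset fun i hi => ?_)
  exact (hν.support_subset i).trans (Set.subset_biUnion_of_mem (u := O)
    ((le_max_left _ _).trans (Finset.mem_Ico.1 hi).1))

theorem hausdorffMeasure_limsup_eq_top [IsProbabilityMeasure m] (hν : IsLevelFamily m s δ g q O ν)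
    (hO : ∀ i, IsOpen (O i)) (hq : ∀ i, 0 < q i) (hθ : θ < 1) (hstep : ∀ i, q (i + 1) ≤ θ * q i)
    (hg : ∀ i, 0 < g i) (hsum : ¬ Summable g) (hs : 0 ≤ s) (hsδ : s < δ) :
    μH[s] (limsup O atTop) = ∞ := by
  rw [limsup_eq_iInf_iSup_of_nat]
  refine hausdorffMeasure_eq_top_of_refining
    (𝓜 := {μ : ProbabilityMeasure Ω | HasBoundedDensity (μ : Measure Ω) m})
    ⟨⟨m, ‹_›⟩, 1, (one_smul _ m).ge⟩ (fun N => isOpen_biUnion fun i _ => hO i) hs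
    fun ε hε μ hμ => hν.exists_refinement hq hθ hstep hg hsum hsδ hε hμ

end IsLevelFamily

end LevelFamilyRefinement

section AhlforsRegular

variable {Ω : Type*} [MetricSpace Ω] [MeasurableSpace Ω] {m : Measure Ω} {δ a b r₀ : ℝ}

/-- The measure condition (M2) with explicit constants. -/
structure IsAhlforsRegular (m : Measure Ω) (δ a b r₀ : ℝ) : Prop where
  lower_pos : 0 < a
  upper_pos : 0 < b
  le_measure_ball : ∀ x r, 0 < r → r ≤ r₀ → ENNReal.ofReal (a * r ^ δ) ≤ m (ball x r)
  measure_ball_le : ∀ x r, 0 < r → r ≤ r₀ → m (ball x r) ≤ ENNReal.ofReal (b * r ^ δ)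

theorem IsAhlforsRegular.measure_ball_mul_le (h : IsAhlforsRegular m δ a b r₀) {k r : ℝ}
    (hk : 0 < k) (hr : 0 < r) (hkr : k * r ≤ r₀) (hr₀ : r ≤ r₀) (x y : Ω) :
    m (ball x (k * r)) ≤ ENNReal.ofReal (b / a * k ^ δ) * m (ball y r) := by
  have ha := h.lower_pos
  have hb := h.upper_pos
  calc m (ball x (k * r)) ≤ ENNReal.ofReal (b * (k * r) ^ δ) :=
        h.measure_ball_le x _ (mul_pos hk hr) hkr
    _ = ENNReal.ofReal (b / a * k ^ δ) * ENNReal.ofReal (a * r ^ δ) := by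
        rw [← ENNReal.ofReal_mul (by positivity), Real.mul_rpow hk.le hr.le]
        congr 1
        field_simp
    _ ≤ ENNReal.ofReal (b / a * k ^ δ) * m (ball y r) := by
        gcongr
        exact h.le_measure_ball y r hr hr₀

end AhlforsRegular

section ResonantNet

variable {Ω J : Type*} [MetricSpace Ω] {R : J → Set Ω} {ρ q t : ℝ} {n : ℕ} {c : Fin n → Ω}
  {σ : Fin n → J}

/-- A maximal `3 * ρ`-separated set of points `c i` of the resonant sets, with a choice of a
resonant set `R (σ i)` through each of them. -/
structure IsResonantNet (R : J → Set Ω) (ρ : ℝ) (c : Fin n → Ω) (σ : Fin n → J) : Prop where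
  mem : ∀ i, c i ∈ R (σ i)
  separated : Pairwise fun i j => 3 * ρ < dist (c i) (c j)
  cover : ∀ α, ∀ y ∈ R α, ∃ i, dist y (c i) ≤ 3 * ρ

theorem exists_isResonantNet [CompactSpace Ω] (R : J → Set Ω) (hρ : 0 < ρ) :
    ∃ (n : ℕ) (c : Fin n → Ω) (σ : Fin n → J), IsResonantNet R ρ c σ := by
  obtain ⟨n, c, hc, hsep, hcov⟩ := exists_separated_net
    (isCompact_univ.totallyBounded.subset (Set.subset_univ (⋃ α, R α))) (mul_pos three_pos hρ)
  choose σ hσ using fun i => Set.mem_iUnion.1 (hc i)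
  exact ⟨n, c, σ, hσ, hsep, fun α y hy => hcov y (Set.mem_iUnion_of_mem α hy)⟩

/-- The part of the `q`-neighbourhood of the resonant set `R (σ i)` near the net point `c i`. -/
def cell (R : J → Set Ω) (ρ q : ℝ) (c : Fin n → Ω) (σ : Fin n → J) (i : Fin n) : Set Ω :=
  ball (c i) (1 / 2 * ρ) ∩ thickening q (R (σ i))

theorem cell_subset_ball (i : Fin n) : cell R ρ q c σ i ⊆ ball (c i) (1 / 2 * ρ) :=
  Set.inter_subset_left

theorem exists_inter_cell_subset (hqt : q ≤ t) {x : Ω} {i : Fin n}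
    (hi : (cell R ρ q c σ i ∩ ball x t).Nonempty) :
    ∃ y ∈ R (σ i), ball x t ∩ cell R ρ q c σ i ⊆
      ball y (3 * t) ∩ ball (c i) (1 / 2 * ρ) ∩ thickening q (R (σ i)) := by
  obtain ⟨z, hz, hzx⟩ := hi
  obtain ⟨y, hy, hzy⟩ := mem_thickening_iff.1 hz.2
  refine ⟨y, hy, fun p hp => ⟨⟨?_, hp.2.1⟩, hp.2.2⟩⟩
  have hpx := mem_ball.1 hp.1
  rw [mem_ball] at hzx ⊢
  linarith [dist_triangle4_right p y z z, dist_triangle p z y, dist_triangle_right p z x]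

namespace IsResonantNet

theorem eq_of_inter_nonempty (h : IsResonantNet R ρ c σ) (ht : t ≤ ρ) {x : Ω} {i j : Fin n}
    (hi : (cell R ρ q c σ i ∩ ball x t).Nonempty) (hj : (cell R ρ q c σ j ∩ ball x t).Nonempty) :
    i = j := by
  obtain ⟨y, hyi, hyx⟩ := hi
  obtain ⟨z, hzj, hzx⟩ := hj
  have hyc := mem_ball.1 (cell_subset_ball i hyi)
  have hzc := mem_ball.1 (cell_subset_ball j hzj)
  rw [mem_ball] at hyx hzx
  refine h.separated.eq fun hij => ?_
  linarith [dist_triangle4 (c i) y z (c j), dist_comm (c i) y, dist_triangle_right y z x]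

theorem pairwise_disjoint_ball (h : IsResonantNet R ρ c σ) (hρ : 0 < ρ) :
    Pairwise (Function.onFun Disjoint fun i => ball (c i) ρ) := fun i j hij =>
  ball_disjoint_ball (by linarith [h.separated hij])

theorem inter_iUnion_thickening_subset (h : IsResonantNet R ρ c σ) (x : Ω) {r : ℝ}
    (hr : 9 * ρ ≤ r) : ball x (r / 2) ∩ ⋃ α, thickening ρ (R α) ⊆
      ⋃ i ∈ {i | cell R ρ q c σ i ⊆ ball x r}, ball (c i) (4 * ρ) := by
  rintro y ⟨hyx, hy⟩
  obtain ⟨α, hyα⟩ := Set.mem_iUnion.1 hy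
  obtain ⟨z, hz, hyz⟩ := mem_thickening_iff.1 hyα
  obtain ⟨i, hi⟩ := h.cover α z hz
  have hyc : dist y (c i) < 4 * ρ := by linarith [dist_triangle y z (c i)]
  refine Set.mem_biUnion (x := i) (fun p hp => ?_) hyc
  have hpc := mem_ball.1 (cell_subset_ball i hp)
  rw [mem_ball] at hyx ⊢
  linarith [dist_triangle4 p (c i) y x, dist_comm (c i) y]

end IsResonantNet

end ResonantNet

section ScaleIdentities

variable {δ γ s ρ q t e : ℝ}

theorem rpow_mul_rpow_le_of_le (hρ : 0 < ρ) (hq : 0 < q) (ht : 0 < t) (htq : t ≤ q)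
    (he : e ≤ δ - s) : (ρ / q) ^ (δ - γ) * t ^ δ ≤
      (q ^ (s - γ) * ρ ^ (γ - δ))⁻¹ * t ^ s * min (t / q) (q / t) ^ e := by
  have hmin : min (t / q) (q / t) = t / q :=
    min_eq_left (((div_le_one hq).2 htq).trans ((one_le_div ht).2 htq))
  calc (ρ / q) ^ (δ - γ) * t ^ δ
      = (q ^ (s - γ) * ρ ^ (γ - δ))⁻¹ * t ^ s * (t / q) ^ (δ - s) := by
        simp only [Real.div_rpow hρ.le hq.le, Real.div_rpow ht.le hq.le, Real.rpow_sub hρ,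
          Real.rpow_sub hq, Real.rpow_sub ht]
        field_simp
    _ ≤ (q ^ (s - γ) * ρ ^ (γ - δ))⁻¹ * t ^ s * min (t / q) (q / t) ^ e := by
        rw [hmin]
        gcongr ?_ * ?_
        exact Real.rpow_le_rpow_of_exponent_ge (div_pos ht hq) ((div_le_one hq).2 htq) he

theorem rpow_mul_rpow_le_of_ge (hρ : 0 < ρ) (hq : 0 < q) (hqt : q ≤ t) (he : e ≤ s - γ) :
    (ρ / q) ^ (δ - γ) * ((t / q) ^ γ * q ^ δ) ≤
      (q ^ (s - γ) * ρ ^ (γ - δ))⁻¹ * t ^ s * min (t / q) (q / t) ^ e := by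
  have ht := hq.trans_le hqt
  have hmin : min (t / q) (q / t) = q / t :=
    min_eq_right (((div_le_one ht).2 hqt).trans ((one_le_div hq).2 hqt))
  calc (ρ / q) ^ (δ - γ) * ((t / q) ^ γ * q ^ δ)
      = (q ^ (s - γ) * ρ ^ (γ - δ))⁻¹ * t ^ s * (q / t) ^ (s - γ) := by
        simp only [Real.div_rpow hρ.le hq.le, Real.div_rpow ht.le hq.le,
          Real.div_rpow hq.le ht.le, Real.rpow_sub hρ, Real.rpow_sub hq, Real.rpow_sub ht]
        field_simp
    _ ≤ (q ^ (s - γ) * ρ ^ (γ - δ))⁻¹ * t ^ s * min (t / q) (q / t) ^ e := by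
        rw [hmin]
        gcongr ?_ * ?_
        exact Real.rpow_le_rpow_of_exponent_ge (div_pos hq ht) ((div_le_one ht).2 hqt) he

end ScaleIdentities

section LevelMeasure

variable {Ω J : Type*} [MetricSpace Ω] [MeasurableSpace Ω] {m : Measure Ω} {R : J → Set Ω}
  {δ γ s a b c₁ c₂ r₀ ρ q t e : ℝ} {n : ℕ} {c : Fin n → Ω} {σ : Fin n → J}

/-- The intersection conditions of a family of resonant sets at one scale `ρ`, for neighbourhoods
of one radius `q ≤ ρ`. -/
structure HasIntersectionBounds (m : Measure Ω) (R : J → Set Ω) (γ c₁ c₂ ρ q : ℝ) : Prop where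
  lower_pos : 0 < c₁
  upper_pos : 0 < c₂
  radius_pos : 0 < q
  radius_le : q ≤ ρ
  le_measure : ∀ α, ∀ c ∈ R α, ENNReal.ofReal (c₁ * (ρ / q) ^ γ) * m (ball c q) ≤
    m (ball c (1 / 2 * ρ) ∩ thickening q (R α))
  measure_le : ∀ α, ∀ c ∈ R α, ∀ y ∈ R α, ∀ r, 0 < r → r ≤ 3 * ρ →
    m (ball y r ∩ ball c (3 * ρ) ∩ thickening (3 * q) (R α)) ≤
      ENNReal.ofReal (c₂ * (r / q) ^ γ) * m (ball c q)

theorem HasIntersectionBounds.measure_ball_le (hR : HasIntersectionBounds m R γ c₁ c₂ ρ q)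
    (hm : IsAhlforsRegular m δ a b r₀) (hρ : ρ ≤ r₀) {α : J} {x : Ω} (hx : x ∈ R α) :
    m (ball x ρ) ≤ ENNReal.ofReal (b / (c₁ * a) * (ρ / q) ^ (δ - γ)) *
      m (ball x (1 / 2 * ρ) ∩ thickening q (R α)) := by
  have ha := hm.lower_pos
  have hb := hm.upper_pos
  have hc₁ := hR.lower_pos
  have hq := hR.radius_pos
  have hρ₀ := hq.trans_le hR.radius_le
  have hρq : ρ / q * q = ρ := div_mul_cancel₀ ρ hq.ne'
  calc m (ball x ρ) = m (ball x (ρ / q * q)) := by rw [hρq]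
    _ ≤ ENNReal.ofReal (b / a * (ρ / q) ^ δ) * m (ball x q) :=
        hm.measure_ball_mul_le (by positivity) hq (by rwa [hρq]) (hR.radius_le.trans hρ) x x
    _ = ENNReal.ofReal (b / (c₁ * a) * (ρ / q) ^ (δ - γ)) *
          (ENNReal.ofReal (c₁ * (ρ / q) ^ γ) * m (ball x q)) := by
        rw [← mul_assoc, ← ENNReal.ofReal_mul (by positivity), Real.rpow_sub (by positivity)]
        congr 2
        field_simp
    _ ≤ _ := by
        gcongr
        exact hR.le_measure α x hx

theorem measurableSet_cell [OpensMeasurableSpace Ω] (i : Fin n) :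
    MeasurableSet (cell R ρ q c σ i) :=
  (isOpen_ball.inter isOpen_thickening).measurableSet

namespace IsResonantNet

theorem measure_ball_le_mul_cell (h : IsResonantNet R ρ c σ)
    (hR : HasIntersectionBounds m R γ c₁ c₂ ρ q) (hm : IsAhlforsRegular m δ a b r₀) (hρ : ρ ≤ r₀)
    (i : Fin n) : m (ball (c i) ρ) ≤
      ENNReal.ofReal (b / (c₁ * a) * (ρ / q) ^ (δ - γ)) * m (cell R ρ q c σ i) :=
  hR.measure_ball_le hm hρ (h.mem i)

theorem measure_ball_inter_iUnion_cell_le (h : IsResonantNet R ρ c σ)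
    (hR : HasIntersectionBounds m R γ c₁ c₂ ρ q) (hm : IsAhlforsRegular m δ a b r₀) (hρ : ρ ≤ r₀)
    (x : Ω) (hqt : q ≤ t) (htρ : t ≤ ρ) :
    m (ball x t ∩ ⋃ i, cell R ρ q c σ i) ≤
      ENNReal.ofReal (c₂ * (3 * t / q) ^ γ * (b * q ^ δ)) := by
  have hc₂ := hR.upper_pos
  have hq := hR.radius_pos
  have ht := hq.trans_le hqt
  by_cases hx : ∃ i, (cell R ρ q c σ i ∩ ball x t).Nonempty
  · obtain ⟨i, hi⟩ := hx
    obtain ⟨y, hy, hsub⟩ := exists_inter_cell_subset hqt hi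
    have hball : ball x t ∩ ⋃ j, cell R ρ q c σ j ⊆
        ball y (3 * t) ∩ ball (c i) (3 * ρ) ∩ thickening (3 * q) (R (σ i)) := by
      rintro p ⟨hpx, hp⟩
      obtain ⟨j, hj⟩ := Set.mem_iUnion.1 hp
      obtain rfl := h.eq_of_inter_nonempty htρ hi ⟨p, hj, hpx⟩
      obtain ⟨⟨hpy, hpc⟩, hpR⟩ := hsub ⟨hpx, hj⟩
      exact ⟨⟨hpy, ball_subset_ball (by linarith) hpc⟩, thickening_mono (by linarith) _ hpR⟩
    rw [ENNReal.ofReal_mul (by positivity)]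
    refine (measure_mono hball).trans ((hR.measure_le _ _ (h.mem i) y hy (3 * t) (by linarith)
      (by linarith)).trans ?_)
    gcongr
    exact hm.measure_ball_le _ q hq (by linarith)
  · have hempty : ball x t ∩ ⋃ i, cell R ρ q c σ i = ∅ := by
      refine Set.eq_empty_of_forall_notMem fun p ⟨hpx, hp⟩ => ?_
      obtain ⟨i, hi⟩ := Set.mem_iUnion.1 hp
      exact hx ⟨i, p, hi, hpx⟩
    rw [hempty, measure_empty]
    exact zero_le

theorem rpow_mul_measure_ball_inter_iUnion_cell_le (h : IsResonantNet R ρ c σ)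
    (hR : HasIntersectionBounds m R γ c₁ c₂ ρ q) (hm : IsAhlforsRegular m δ a b r₀) (hρ : ρ ≤ r₀)
    (x : Ω) (ht : 0 < t) (htρ : t ≤ ρ) (heδ : e ≤ δ - s) (heγ : e ≤ s - γ) :
    ENNReal.ofReal ((ρ / q) ^ (δ - γ)) * m (ball x t ∩ ⋃ i, cell R ρ q c σ i) ≤
      ENNReal.ofReal (b * (1 + c₂ * 3 ^ γ) *
        ((q ^ (s - γ) * ρ ^ (γ - δ))⁻¹ * t ^ s * min (t / q) (q / t) ^ e)) := by
  have hb := hm.upper_pos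
  have hc₂ := hR.upper_pos
  have hq := hR.radius_pos
  have hρ₀ := ht.trans_le htρ
  suffices ∃ V, m (ball x t ∩ ⋃ i, cell R ρ q c σ i) ≤ ENNReal.ofReal V ∧
      (ρ / q) ^ (δ - γ) * V ≤ b * (1 + c₂ * 3 ^ γ) *
        ((q ^ (s - γ) * ρ ^ (γ - δ))⁻¹ * t ^ s * min (t / q) (q / t) ^ e) by
    obtain ⟨V, hmV, hV⟩ := this
    refine (mul_le_mul_right hmV _).trans ?_
    rw [← ENNReal.ofReal_mul (by positivity)]
    exact ENNReal.ofReal_le_ofReal hV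
  rcases le_total t q with htq | hqt
  · refine ⟨b * t ^ δ, (measure_mono Set.inter_subset_left).trans
      (hm.measure_ball_le x t ht (htρ.trans hρ)), ?_⟩
    rw [mul_left_comm]
    gcongr ?_ * ?_
    · exact le_mul_of_one_le_right hb.le (le_add_of_nonneg_right (by positivity))
    · exact rpow_mul_rpow_le_of_le hρ₀ hq ht htq heδ
  · refine ⟨_, h.measure_ball_inter_iUnion_cell_le hR hm hρ x hqt htρ, ?_⟩
    calc (ρ / q) ^ (δ - γ) * (c₂ * (3 * t / q) ^ γ * (b * q ^ δ))
        = b * (c₂ * 3 ^ γ) * ((ρ / q) ^ (δ - γ) * ((t / q) ^ γ * q ^ δ)) := by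
          rw [mul_div_assoc, Real.mul_rpow three_pos.le (div_pos ht hq).le]
          ring
      _ ≤ _ := by
        gcongr ?_ * ?_ * ?_
        · exact le_add_of_nonneg_left one_pos.le
        · exact rpow_mul_rpow_le_of_ge hρ₀ hq hqt heγ

end IsResonantNet

/-- The measure which pushes the `m`-mass of each ball `ball (c i) ρ` onto the cell in it. -/
noncomputable def levelMeasure (m : Measure Ω) (R : J → Set Ω) (ρ q : ℝ) (c : Fin n → Ω)
    (σ : Fin n → J) : Measure Ω :=
  spread m (cell R ρ q c σ) fun i => m (ball (c i) ρ)

namespace IsResonantNet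

theorem measure_ball_inter_thickening_le [IsFiniteMeasure m] (h : IsResonantNet R ρ c σ)
    (hR : HasIntersectionBounds m R γ c₁ c₂ ρ q) (hm : IsAhlforsRegular m δ a b r₀)
    (hρ : 4 * ρ ≤ r₀) (x : Ω) {r : ℝ} (hr : 9 * ρ ≤ r) :
    m (ball x (r / 2) ∩ ⋃ α, thickening ρ (R α)) ≤
      ENNReal.ofReal (b / a * 4 ^ δ) * levelMeasure m R ρ q c σ (ball x r) := by
  classical
  have hρ₀ := hR.radius_pos.trans_le hR.radius_le
  have hρr : ρ ≤ r₀ := by linarith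
  set S : Finset (Fin n) := {i | cell R ρ q c σ i ⊆ ball x r} with hS
  calc m (ball x (r / 2) ∩ ⋃ α, thickening ρ (R α))
      ≤ m (⋃ i ∈ S, ball (c i) (4 * ρ)) := by
        refine measure_mono ((h.inter_iUnion_thickening_subset (q := q) x hr).trans_eq ?_)
        simp only [hS, Finset.mem_filter_univ, Set.mem_ofPred_eq]
    _ ≤ ∑ i ∈ S, m (ball (c i) (4 * ρ)) := measure_biUnion_finset_le _ _
    _ ≤ ∑ i ∈ S, ENNReal.ofReal (b / a * 4 ^ δ) * m (ball (c i) ρ) :=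
        Finset.sum_le_sum fun i _ => hm.measure_ball_mul_le four_pos hρ₀ hρ hρr _ _
    _ ≤ ENNReal.ofReal (b / a * 4 ^ δ) * levelMeasure m R ρ q c σ (ball x r) := by
        rw [← Finset.mul_sum]
        gcongr
        refine sum_le_spread_apply (fun i hi => ?_) fun i hi => (Finset.mem_filter.1 hi).2
        simpa only [hi, mul_zero, nonpos_iff_eq_zero] using h.measure_ball_le_mul_cell hR hm hρr i

theorem measure_ball_le_mul_levelMeasure_ball [IsFiniteMeasure m] (h : IsResonantNet R ρ c σ)
    (hR : HasIntersectionBounds m R γ c₁ c₂ ρ q) (hm : IsAhlforsRegular m δ a b r₀)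
    (hρ : 4 * ρ ≤ r₀) (x : Ω) {r κ : ℝ} (hr : 9 * ρ ≤ r) (hrr : 3 * r ≤ r₀) (hκ : 0 < κ)
    (hub : ENNReal.ofReal κ * m (ball x (r / 2)) ≤
      m (ball x (r / 2) ∩ ⋃ α, thickening ρ (R α))) :
    m (ball x (3 * r)) ≤ ENNReal.ofReal (b / a * 6 ^ δ * (κ⁻¹ * (b / a * 4 ^ δ))) *
      levelMeasure m R ρ q c σ (ball x r) := by
  have ha := hm.lower_pos
  have hb := hm.upper_pos
  have hr₀ : 0 < r := (mul_pos (by norm_num) (hR.radius_pos.trans_le hR.radius_le)).trans_le hr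
  calc m (ball x (3 * r)) = m (ball x (6 * (r / 2))) := by ring_nf
    _ ≤ ENNReal.ofReal (b / a * 6 ^ δ) * m (ball x (r / 2)) :=
        hm.measure_ball_mul_le (by norm_num) (half_pos hr₀) (by linarith) (by linarith) _ _
    _ = ENNReal.ofReal (b / a * 6 ^ δ) *
          (ENNReal.ofReal κ⁻¹ * (ENNReal.ofReal κ * m (ball x (r / 2)))) := by
        rw [← mul_assoc (ENNReal.ofReal κ⁻¹), ← ENNReal.ofReal_mul (inv_pos.2 hκ).le,
          inv_mul_cancel₀ hκ.ne', ENNReal.ofReal_one, one_mul]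
    _ ≤ ENNReal.ofReal (b / a * 6 ^ δ) * (ENNReal.ofReal κ⁻¹ *
          (ENNReal.ofReal (b / a * 4 ^ δ) * levelMeasure m R ρ q c σ (ball x r))) := by
        gcongr _ * (_ * ?_)
        exact hub.trans (h.measure_ball_inter_thickening_le hR hm hρ x hr)
    _ = _ := by
        rw [← mul_assoc, ← mul_assoc, mul_assoc (ENNReal.ofReal _),
          ← ENNReal.ofReal_mul (inv_pos.2 hκ).le, ← ENNReal.ofReal_mul (by positivity)]

end IsResonantNet

variable [OpensMeasurableSpace Ω]

theorem levelMeasure_support_subset :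
    (levelMeasure m R ρ q c σ).support ⊆ ⋃ α, cthickening q (R α) := by
  have hclosed : IsClosed (⋃ i, cthickening q (R (σ i))) :=
    isClosed_iUnion_of_finite fun i => isClosed_cthickening
  refine (Measure.support_subset_of_isClosed hclosed (mem_ae_iff.2 ?_)).trans
    (Set.iUnion_subset fun i => Set.subset_iUnion (fun α => cthickening q (R α)) (σ i))
  classical
  refine le_antisymm ((spread_apply_le measurableSet_cell _ _).trans_eq ?_) zero_le
  refine Finset.sum_eq_zero fun i hi => ?_
  obtain ⟨z, hz, hzC⟩ := (Finset.mem_filter.1 hi).2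
  exact absurd (Set.mem_iUnion_of_mem i (thickening_subset_cthickening _ _ hz.2)) hzC

namespace IsResonantNet

theorem levelMeasure_le_smul_restrict (h : IsResonantNet R ρ c σ)
    (hR : HasIntersectionBounds m R γ c₁ c₂ ρ q) (hm : IsAhlforsRegular m δ a b r₀)
    (hρ : ρ ≤ r₀) :
    levelMeasure m R ρ q c σ ≤ ENNReal.ofReal (b / (c₁ * a) * (ρ / q) ^ (δ - γ)) •
      m.restrict (⋃ i, cell R ρ q c σ i) := by
  have hρ₀ := hR.radius_pos.trans_le hR.radius_le
  refine spread_le_smul_restrict measurableSet_cell (fun i j hij => ?_)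
    (h.measure_ball_le_mul_cell hR hm hρ)
  exact (h.pairwise_disjoint_ball hρ₀ hij).mono
    ((cell_subset_ball i).trans (ball_subset_ball (by linarith)))
    ((cell_subset_ball j).trans (ball_subset_ball (by linarith)))

theorem levelMeasure_ball_le_mul (h : IsResonantNet R ρ c σ)
    (hR : HasIntersectionBounds m R γ c₁ c₂ ρ q) (hm : IsAhlforsRegular m δ a b r₀) (hρ : ρ ≤ r₀)
    (x : Ω) (t : ℝ) : levelMeasure m R ρ q c σ (ball x t) ≤
      ENNReal.ofReal (b / (c₁ * a) * (ρ / q) ^ (δ - γ)) *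
        m (ball x t ∩ ⋃ i, cell R ρ q c σ i) := by
  rw [← Measure.restrict_apply measurableSet_ball]
  exact h.levelMeasure_le_smul_restrict hR hm hρ _

theorem hasBoundedDensity_levelMeasure (h : IsResonantNet R ρ c σ)
    (hR : HasIntersectionBounds m R γ c₁ c₂ ρ q) (hm : IsAhlforsRegular m δ a b r₀)
    (hρ : ρ ≤ r₀) : HasBoundedDensity (levelMeasure m R ρ q c σ) m :=
  ⟨_, (h.levelMeasure_le_smul_restrict hR hm hρ).trans <|
    fun E => mul_le_mul_right (Measure.restrict_le_self E) _⟩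

theorem levelMeasure_ball_le_of_ge (h : IsResonantNet R ρ c σ) (hm : IsAhlforsRegular m δ a b r₀)
    (x : Ω) (hρ : 0 < ρ) (hρt : ρ ≤ t) (htr : 3 * t ≤ r₀) :
    levelMeasure m R ρ q c σ (ball x t) ≤ ENNReal.ofReal (b * (3 * t) ^ δ) := by
  classical
  refine (spread_apply_le measurableSet_cell _ _).trans ?_
  rw [← measure_biUnion_finset (fun i _ j _ hij => h.pairwise_disjoint_ball hρ hij)
    fun i _ => measurableSet_ball]
  refine (measure_mono (Set.iUnion₂_subset fun i hi p hp => ?_)).trans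
    (hm.measure_ball_le x (3 * t) (by linarith) htr)
  obtain ⟨z, hz, hzx⟩ := (Finset.mem_filter.1 hi).2
  have hzc := mem_ball.1 (cell_subset_ball i hz)
  rw [mem_ball] at hp hzx ⊢
  linarith [dist_triangle4 p (c i) z x, dist_comm (c i) z]

theorem levelMeasure_ball_le_of_le (h : IsResonantNet R ρ c σ)
    (hR : HasIntersectionBounds m R γ c₁ c₂ ρ q) (hm : IsAhlforsRegular m δ a b r₀) (hρ : ρ ≤ r₀)
    (x : Ω) (ht : 0 < t) (htρ : t ≤ ρ) (heδ : e ≤ δ - s) (heγ : e ≤ s - γ) :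
    levelMeasure m R ρ q c σ (ball x t) ≤
      ENNReal.ofReal (b ^ 2 / (c₁ * a) * (1 + c₂ * 3 ^ γ) * (q ^ (s - γ) * ρ ^ (γ - δ))⁻¹ *
        t ^ s * min (t / q) (q / t) ^ e) := by
  have ha := hm.lower_pos
  have hb := hm.upper_pos
  have hc₁ := hR.lower_pos
  calc levelMeasure m R ρ q c σ (ball x t)
      ≤ ENNReal.ofReal (b / (c₁ * a) * (ρ / q) ^ (δ - γ)) *
          m (ball x t ∩ ⋃ i, cell R ρ q c σ i) := h.levelMeasure_ball_le_mul hR hm hρ x t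
    _ = ENNReal.ofReal (b / (c₁ * a)) * (ENNReal.ofReal ((ρ / q) ^ (δ - γ)) *
          m (ball x t ∩ ⋃ i, cell R ρ q c σ i)) := by
        rw [ENNReal.ofReal_mul (by positivity), mul_assoc]
    _ ≤ ENNReal.ofReal (b / (c₁ * a)) * ENNReal.ofReal (b * (1 + c₂ * 3 ^ γ) *
          ((q ^ (s - γ) * ρ ^ (γ - δ))⁻¹ * t ^ s * min (t / q) (q / t) ^ e)) := by
        gcongr
        exact h.rpow_mul_measure_ball_inter_iUnion_cell_le hR hm hρ x ht htρ heδ heγ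
    _ = _ := by
        rw [← ENNReal.ofReal_mul (by positivity)]
        ring_nf

theorem levelMeasure_ball_le (h : IsResonantNet R ρ c σ)
    (hR : HasIntersectionBounds m R γ c₁ c₂ ρ q) (hm : IsAhlforsRegular m δ a b r₀) (hρ : ρ ≤ r₀)
    (x : Ω) (ht : 0 < t) (htr : 3 * t ≤ r₀) (heδ : e ≤ δ - s) (heγ : e ≤ s - γ) :
    levelMeasure m R ρ q c σ (ball x t) ≤
      ENNReal.ofReal (b ^ 2 / (c₁ * a) * (1 + c₂ * 3 ^ γ) * (q ^ (s - γ) * ρ ^ (γ - δ))⁻¹ *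
        t ^ s * min (t / q) (q / t) ^ e + b * 3 ^ δ * t ^ δ) := by
  have ha := hm.lower_pos
  have hb := hm.upper_pos
  have hc₁ := hR.lower_pos
  have hc₂ := hR.upper_pos
  have hq := hR.radius_pos
  have hρ₀ := hq.trans_le hR.radius_le
  rcases le_total t ρ with htρ | hρt
  · exact (h.levelMeasure_ball_le_of_le hR hm hρ x ht htρ heδ heγ).trans
      (ENNReal.ofReal_le_ofReal (le_add_of_nonneg_right (by positivity)))
  · refine (h.levelMeasure_ball_le_of_ge hm x hρ₀ hρt htr).trans (ENNReal.ofReal_le_ofReal ?_)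
    rw [Real.mul_rpow three_pos.le ht.le, ← mul_assoc]
    exact le_add_of_nonneg_left (by positivity)

end IsResonantNet

end LevelMeasure

section LevelFamilyExistence

variable {Ω : Type*} [MetricSpace Ω] [CompactSpace Ω] [MeasurableSpace Ω] [OpensMeasurableSpace Ω]
  {m : Measure Ω} [IsFiniteMeasure m] {J : ℕ → Type*} {R : ∀ i, J i → Set Ω}
  {s δ γ a b c₁ c₂ r₀ r₁ κ : ℝ} {P Q : ℕ → ℝ} {O : ℕ → Set Ω}

theorem exists_isLevelFamily (hm : IsAhlforsRegular m δ a b r₀) (hr₀ : 0 < r₀)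
    (hR : ∀ i, HasIntersectionBounds m (R i) γ c₁ c₂ (P i) (Q i)) (hPr₀ : ∀ i, 4 * P i ≤ r₀)
    (hP : Tendsto P atTop (𝓝 0)) (hO : ∀ i, ⋃ α, cthickening (Q i) (R i α) ⊆ O i) (hκ : 0 < κ)
    (hr₁ : 0 < r₁) (hub : ∀ x r, 0 < r → r ≤ r₁ → ∀ᶠ i in atTop,
      ENNReal.ofReal κ * m (ball x r) ≤ m (ball x r ∩ ⋃ α, thickening (P i) (R i α)))
    (hγs : γ < s) (hsδ : s < δ) :
    ∃ ν, IsLevelFamily m s δ (fun i => Q i ^ (s - γ) * P i ^ (γ - δ)) Q O ν := by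
  have ha := hm.lower_pos
  have hb := hm.upper_pos
  have hc₁ := (hR 0).lower_pos
  have hc₂ := (hR 0).upper_pos
  have hP₀ : ∀ i, 0 < P i := fun i => (hR i).radius_pos.trans_le (hR i).radius_le
  have hPr : ∀ i, P i ≤ r₀ := fun i => by linarith [hP₀ i, hPr₀ i]
  choose n c σ hnet using fun i => exists_isResonantNet (R i) (hP₀ i)
  refine ⟨fun i => levelMeasure m (R i) (P i) (Q i) (c i) (σ i),
    fun i => levelMeasure_support_subset.trans (hO i),
    fun i => (hnet i).hasBoundedDensity_levelMeasure (hR i) hm (hPr i),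
    ⟨min (δ - s) (s - γ), lt_min (sub_pos.2 hsδ) (sub_pos.2 hγs),
      ⟨b ^ 2 / (c₁ * a) * (1 + c₂ * 3 ^ γ), by positivity⟩, ⟨b * 3 ^ δ, by positivity⟩, r₀ / 3,
      by positivity, fun i x t ht htr => ?_⟩,
    ⟨(b / a * 6 ^ δ * (κ⁻¹ * (b / a * 4 ^ δ))).toNNReal, min r₁ (r₀ / 3), by positivity,
      fun x r hr hrr => ?_⟩⟩
  · exact (hnet i).levelMeasure_ball_le (hR i) hm (hPr i) x ht (by linarith)
      (min_le_left _ _) (min_le_right _ _)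
  · have hrr₁ : r / 2 ≤ r₁ := by linarith [hrr.trans (min_le_left _ _)]
    have hrr₀ : 3 * r ≤ r₀ := by linarith [hrr.trans (min_le_right _ _)]
    filter_upwards [hub x (r / 2) (half_pos hr) hrr₁,
      hP.eventually_le_const (show 0 < r / 9 by positivity)] with i hubi hPi
    exact (hnet i).measure_ball_le_mul_levelMeasure_ball (hR i) hm (hPr₀ i) x (by linarith) hrr₀
      hκ hubi

end LevelFamilyExistence

section AdmissibleRadii

/-- A choice of radii `q i`, attached to the levels `φ i`, that the construction of level measures
can use: the closed `q i`-neighbourhoods of the resonant sets lie in the `ψ (φ i)`-neighbourhoods,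
the radii decay at least geometrically, and the series of the weights
`q i ^ (s - γ) * ρ (φ i) ^ (γ - δ)` still diverges. -/
structure AdmissibleRadii (ψ ρ : ℕ → ℝ) (s γ δ : ℝ) (φ : ℕ → ℕ) (q : ℕ → ℝ) : Prop where
  strictMono : StrictMono φ
  pos : ∀ i, 0 < q i
  lt : ∀ i, q i < ψ (φ i)
  le : ∀ i, q i ≤ ρ (φ i)
  geometric : ∃ θ < 1, ∀ i, q (i + 1) ≤ θ * q i
  not_summable : ¬ Summable fun i => q i ^ (s - γ) * ρ (φ i) ^ (γ - δ)

variable {ψ ρ : ℕ → ℝ} {s γ δ : ℝ}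

theorem AdmissibleRadii.exists_forall {φ : ℕ → ℕ} {q : ℕ → ℝ} (h : AdmissibleRadii ψ ρ s γ δ φ q)
    {p : ℕ → Prop} (hp : ∀ᶠ n in atTop, p n) :
    ∃ φ q, AdmissibleRadii ψ ρ s γ δ φ q ∧ ∀ i, p (φ i) := by
  obtain ⟨N, hN⟩ := eventually_atTop.1 (h.strictMono.tendsto_atTop.eventually hp)
  obtain ⟨θ, hθ, hstep⟩ := h.geometric
  refine ⟨fun i => φ (i + N), fun i => q (i + N),
    ⟨fun i j hij => h.strictMono (Nat.add_lt_add_right hij N), fun i => h.pos _, fun i => h.lt _,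
      fun i => h.le _, ⟨θ, hθ, fun i => ?_⟩,
      fun hs => h.not_summable ((summable_nat_add_iff N).1 hs)⟩,
    fun i => hN (i + N) (Nat.le_add_left N i)⟩
  rw [add_right_comm]
  exact hstep (i + N)

theorem le_of_rpow_mul_rpow_le_one {x y : ℝ} (hx : 0 < x) (hy : 0 < y) (hy₁ : y ≤ 1)
    (hγs : γ < s) (hsδ : s < δ) (h : x ^ (s - γ) * y ^ (γ - δ) ≤ 1) : x ≤ y := by
  refine (Real.rpow_le_rpow_iff hx.le hy.le (sub_pos.2 hγs)).1 ?_
  calc x ^ (s - γ) ≤ y ^ (δ - γ) := by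
        rwa [← neg_sub δ γ, Real.rpow_neg hy.le, ← div_eq_mul_inv, div_le_one (by positivity)] at h
    _ ≤ y ^ (s - γ) := Real.rpow_le_rpow_of_exponent_ge hy hy₁ (by linarith)

theorem exists_strictMono_of_not_summable_indicator {g : ℕ → ℝ} {S : Set ℕ}
    (h : ¬ Summable (S.indicator g)) :
    ∃ φ : ℕ → ℕ, StrictMono φ ∧ (∀ i, φ i ∈ S) ∧ ¬ Summable (g ∘ φ) := by
  classical
  have hinf : S.Infinite := fun hfin => h <| summable_of_hasFiniteSupport <|
    hfin.subset Set.support_indicator_subset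
  have := hinf.to_subtype
  refine ⟨fun i => Nat.Subtype.orderIsoOfNat S i,
    (Subtype.strictMono_coe _).comp (Nat.Subtype.orderIsoOfNat S).strictMono,
    fun i => Subtype.prop _, fun hs => h ?_⟩
  rw [← summable_subtype_iff_indicator]
  exact ((Nat.Subtype.orderIsoOfNat S).toEquiv.summable_iff (f := g ∘ ((↑) : S → ℕ))).1 hs

-- A step outside the set multiplies `g` by at least `L`, so each maximal run of such steps
-- contributes at most a constant multiple of the term that ends it.
theorem not_summable_indicator_lt_mul {g : ℕ → ℝ} (hg : ∀ n, 0 ≤ g n)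
    (hbdd : BddAbove (Set.range g)) {L : ℝ} (hL : 1 < L) (hsum : ¬ Summable g) :
    ¬ Summable ({n | g (n + 1) < L * g n}.indicator g) := by
  intro h
  set S : Set ℕ := {n | g (n + 1) < L * g n}
  obtain ⟨C, hC⟩ := hbdd
  have hpartial : ∀ N, (L - 1) * ∑ n ∈ Finset.range N, g n ≤
      L * (∑ n ∈ Finset.range N, S.indicator g n) + g N := by
    intro N
    induction N with
    | zero => simpa using hg 0
    | succ N ih =>
      rw [Finset.sum_range_succ, Finset.sum_range_succ]
      by_cases hN : N ∈ S
      · rw [Set.indicator_of_mem hN]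
        linarith [hg (N + 1)]
      · rw [Set.indicator_of_notMem hN]
        linarith [show L * g N ≤ g (N + 1) from not_lt.1 hN]
  refine hsum (summable_of_sum_range_le (c := (L * (∑' n, S.indicator g n) + C) / (L - 1)) hg
    fun N => ?_)
  rw [le_div_iff₀' (by linarith)]
  refine (hpartial N).trans (add_le_add (mul_le_mul_of_nonneg_left ?_ (by linarith))
    (hC (Set.mem_range_self N)))
  exact h.sum_le_tsum _ fun n _ => Set.indicator_nonneg (fun n _ => hg n) n

theorem exists_strictMono_le_half {p : ℕ → ℝ} (hp : ∀ n, 0 < p n) (hp₀ : Tendsto p atTop (𝓝 0))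
    {S : Set ℕ} (hS : ∃ᶠ n in atTop, n ∈ S) :
    ∃ φ : ℕ → ℕ, StrictMono φ ∧ (∀ i, φ i ∈ S) ∧ ∀ i, p (φ (i + 1)) ≤ 1 / 2 * p (φ i) := by
  obtain ⟨φ, hφS, hφ⟩ := exists_seq_of_forall_finset_exists (· ∈ S)
    (fun k n => k < n ∧ p n ≤ 1 / 2 * p k) fun F _ => (hS.and_eventually <|
      (eventually_all_finset F).2 fun k _ => (eventually_gt_atTop k).and <|
        hp₀.eventually_le_const (by have := hp k; positivity)).exists
  exact ⟨φ, fun i j hij => (hφ i j hij).1, hφS, fun i => (hφ i (i + 1) i.lt_succ_self).2⟩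

theorem exists_admissibleRadii_of_subsequence (hψ : ∀ n, 0 < ψ n) {φ : ℕ → ℕ}
    (hφ : StrictMono φ) {θ : ℝ} (hθ : θ < 1)
    (hstep : ∀ᶠ i in atTop, ψ (φ (i + 1)) ≤ θ * ψ (φ i))
    (hle : ∀ᶠ i in atTop, ψ (φ i) ≤ ρ (φ i))
    (hsum : ¬ Summable fun i => ψ (φ i) ^ (s - γ) * ρ (φ i) ^ (γ - δ)) :
    ∃ φ q, AdmissibleRadii ψ ρ s γ δ φ q := by
  obtain ⟨N, hN⟩ := eventually_atTop.1 (hstep.and hle)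
  refine ⟨fun i => φ (i + N), fun i => 1 / 2 * ψ (φ (i + N)),
    ⟨fun i j hij => hφ (Nat.add_lt_add_right hij N), fun i => ?_, fun i => ?_, fun i => ?_,
      ⟨θ, hθ, fun i => ?_⟩, fun h => hsum ?_⟩⟩
  · exact mul_pos one_half_pos (hψ _)
  · linarith [hψ (φ (i + N))]
  · linarith [hψ (φ (i + N)), (hN (i + N) (Nat.le_add_left N i)).2]
  · have := (hN (i + N) (Nat.le_add_left N i)).1
    rw [add_right_comm] at this
    linarith
  · have hhalf : ((1 : ℝ) / 2) ^ (s - γ) ≠ 0 := by positivity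
    refine (summable_nat_add_iff N).1 ((summable_mul_left_iff hhalf).1 (h.congr fun i => ?_))
    rw [Real.mul_rpow one_half_pos.le (hψ _).le, mul_assoc]

theorem le_rpow_mul_of_rpow_mul_rpow_lt {x x' y y' θ : ℝ} (hx : 0 < x) (hx' : 0 < x') (hy : 0 < y)
    (hy' : 0 < y') (hθ : 0 < θ) (hγs : γ < s) (hγδ : γ < δ) (hyy' : y' ≤ θ * y)
    (h : x' ^ (s - γ) * y' ^ (γ - δ) < θ ^ ((γ - δ) / 2) * (x ^ (s - γ) * y ^ (γ - δ))) :
    x' ≤ θ ^ ((δ - γ) / 2 / (s - γ)) * x := by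
  have hsγ : 0 < s - γ := sub_pos.2 hγs
  refine (Real.rpow_le_rpow_iff hx'.le (by positivity) hsγ).1 ?_
  have hyγ : (θ * y) ^ (γ - δ) ≤ y' ^ (γ - δ) :=
    Real.rpow_le_rpow_of_nonpos hy' hyy' (by linarith)
  have hpow : (θ ^ ((δ - γ) / 2 / (s - γ)) * x) ^ (s - γ) * (θ * y) ^ (γ - δ) =
      θ ^ ((γ - δ) / 2) * (x ^ (s - γ) * y ^ (γ - δ)) := by
    rw [Real.mul_rpow (by positivity) hx.le, Real.mul_rpow hθ.le hy.le, ← Real.rpow_mul hθ.le,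
      div_mul_cancel₀ _ hsγ.ne', mul_mul_mul_comm, ← Real.rpow_add hθ]
    ring_nf
  refine le_of_mul_le_mul_right ?_ (show 0 < (θ * y) ^ (γ - δ) by positivity)
  calc x' ^ (s - γ) * (θ * y) ^ (γ - δ) ≤ x' ^ (s - γ) * y' ^ (γ - δ) := by gcongr
    _ ≤ _ := h.le.trans_eq hpow.symm

-- If `ρ` decays geometrically, then the divergence of the series is caused by the indices at which
-- `ψ` drops by a definite factor, because the summand grows geometrically at all the others.
theorem exists_admissibleRadii_of_regular (hψ : ∀ n, 0 < ψ n) (hψa : Antitone ψ)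
    (hρ : ∀ n, 0 < ρ n) (hγs : γ < s) (hγδ : γ < δ) (hle : ∀ᶠ n in atTop, ψ n ≤ ρ n)
    (hbdd : BddAbove (Set.range fun n => ψ n ^ (s - γ) * ρ n ^ (γ - δ)))
    {θ : ℝ} (hθ₀ : 0 < θ) (hθ : θ < 1) (hstep : ∀ᶠ n in atTop, ρ (n + 1) ≤ θ * ρ n)
    (hsum : ¬ Summable fun n => ψ n ^ (s - γ) * ρ n ^ (γ - δ)) :
    ∃ φ q, AdmissibleRadii ψ ρ s γ δ φ q := by
  have hL : 1 < θ ^ ((γ - δ) / 2) := Real.one_lt_rpow_of_pos_of_lt_one_of_neg hθ₀ hθ (by linarith)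
  obtain ⟨φ, hφ, hφS, hφsum⟩ := exists_strictMono_of_not_summable_indicator <|
    not_summable_indicator_lt_mul
      (fun n => by have := hψ n; have := hρ n; positivity) hbdd hL hsum
  have hexp : 0 < (δ - γ) / 2 / (s - γ) := div_pos (by linarith) (sub_pos.2 hγs)
  refine exists_admissibleRadii_of_subsequence hψ hφ (Real.rpow_lt_one hθ₀.le hθ hexp) ?_
    (hφ.tendsto_atTop.eventually hle) hφsum
  filter_upwards [hφ.tendsto_atTop.eventually hstep] with i hi
  exact (hψa (Nat.succ_le_of_lt (hφ i.lt_succ_self))).trans <|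
    le_rpow_mul_of_rpow_mul_rpow_lt (hψ _) (hψ _) (hρ _) (hρ _) hθ₀ hγs hγδ hi (hφS i)

-- The radii are chosen so that every weight is equal to the same constant.
theorem exists_admissibleRadii_of_frequently_lt (hψ : ∀ n, 0 < ψ n) (hρ : ∀ n, 0 < ρ n)
    (hρ₀ : Tendsto ρ atTop (𝓝 0)) (hγs : γ < s) (hsδ : s < δ) {c : ℝ} (hc : 0 < c)
    (hfreq : ∃ᶠ n in atTop, c < ψ n ^ (s - γ) * ρ n ^ (γ - δ)) :
    ∃ φ q, AdmissibleRadii ψ ρ s γ δ φ q := by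
  wlog hc₁ : c ≤ 1 generalizing c
  · exact this one_pos (hfreq.mono fun n => (not_le.1 hc₁).trans) le_rfl
  have hsγ : 0 < s - γ := sub_pos.2 hγs
  set p : ℕ → ℝ := fun n => (c * ρ n ^ (δ - γ)) ^ (s - γ)⁻¹
  have hp : ∀ n, 0 < p n := fun n => by have := hρ n; positivity
  have hweight : ∀ n, p n ^ (s - γ) * ρ n ^ (γ - δ) = c := by
    intro n
    have := hρ n
    rw [← Real.rpow_mul (by positivity), inv_mul_cancel₀ hsγ.ne', Real.rpow_one, mul_assoc,
      ← Real.rpow_add this, sub_add_sub_cancel, sub_self, Real.rpow_zero, mul_one]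
  have hp₀ : Tendsto p atTop (𝓝 0) := by
    have hρδ := (hρ₀.rpow_const (p := δ - γ) (Or.inr (by linarith))).const_mul c
    have hlim := hρδ.rpow_const (p := (s - γ)⁻¹) (Or.inr (by positivity))
    rwa [Real.zero_rpow (by linarith), mul_zero, Real.zero_rpow (by positivity)] at hlim
  obtain ⟨φ, hφ, hφS, hhalf⟩ := exists_strictMono_le_half (S := {n | _ ∧ _}) hp hp₀
    (hfreq.and_eventually (hρ₀.eventually_le_const one_pos))
  refine ⟨φ, p ∘ φ, hφ, fun i => hp _, fun i => ?_, fun i => ?_,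
    ⟨1 / 2, one_half_lt_one, hhalf⟩, ?_⟩
  · have hlt := (hweight (φ i)).trans_lt (hφS i).1
    exact (Real.rpow_lt_rpow_iff (hp _).le (hψ _).le hsγ).1
      (lt_of_mul_lt_mul_right hlt (Real.rpow_nonneg (hρ _).le _))
  · exact le_of_rpow_mul_rpow_le_one (hp _) (hρ _) (hφS i).2 hγs hsδ ((hweight _).trans_le hc₁)
  · simp only [Function.comp_apply, hweight, summable_const_iff]
    exact hc.ne'

end AdmissibleRadii

section LimsupSet

variable {Ω J : Type*} [MetricSpace Ω] {R : J → Set Ω} {β : J → ℝ} {l u : ℕ → ℝ} {ψ : ℝ → ℝ}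

theorem limsup_iUnion_thickening_subset_limsupSet (hβ : ∀ α, 0 < β α)
    (hl : Tendsto l atTop atTop) (hψ : AntitoneOn ψ (Set.Ioi 0)) :
    limsup (fun n => ⋃ α : {α | l n < β α ∧ β α ≤ u n}, thickening (ψ (u n)) (R α)) atTop ⊆
      limsupSet R β ψ := by
  intro x hx hfin
  obtain ⟨K, hK⟩ := (hfin.image β).bddAbove
  obtain ⟨n, hxn, hn⟩ := ((mem_limsup_iff_frequently_mem.1 hx).and_eventually
    (hl.eventually_ge_atTop K)).exists
  obtain ⟨⟨α, hlα, hαu⟩, hxα⟩ := Set.mem_iUnion.1 hxn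
  have hαK : β α ≤ K := hK <| Set.mem_image_of_mem β <|
    thickening_mono (hψ (hβ α) ((hβ α).trans_le hαu) hαu) _ hxα
  exact hlα.not_ge (hαK.trans hn)

theorem exists_eventually_hasIntersectionBounds [MeasurableSpace Ω] {m : Measure Ω} {ρ : ℝ → ℝ}
    {γ : ℝ} (h : IntersectionConditions m R β ρ u γ) :
    ∃ c₁ c₂, ∀ᶠ n in atTop, ∀ q, 0 < q → q ≤ ρ (u n) →
      HasIntersectionBounds m (fun α : {α | l n < β α ∧ β α ≤ u n} => R α) γ c₁ c₂ (ρ (u n)) q := by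
  obtain ⟨-, -, c₁, c₂, hc₁, hc₂, hint⟩ := h
  refine ⟨c₁, c₂, hint.mono fun n hn q hq hqρ => ⟨hc₁, hc₂, hq, hqρ, fun α c hc => ?_,
    fun α c hc y hy => ?_⟩⟩
  · exact (hn α α.2.2 c hc q hq hqρ).1
  · exact (hn α α.2.2 c hc q hq hqρ).2 α y hy

theorem MeasureM2.exists_isAhlforsRegular [MeasurableSpace Ω] {m : Measure Ω} {δ : ℝ}
    (h : MeasureM2 m δ) : ∃ a b r₀, 0 < r₀ ∧ IsAhlforsRegular m δ a b r₀ := by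
  obtain ⟨-, a, b, r₀, ha, hb, hr₀, hball⟩ := h
  exact ⟨a, b, r₀, hr₀, ha, hb, fun x r hr hrr => (hball x r hr hrr).1,
    fun x r hr hrr => (hball x r hr hrr).2⟩

variable [CompactSpace Ω] [MeasurableSpace Ω] [BorelSpace Ω] {m : Measure Ω}
  [IsProbabilityMeasure m] {ρ : ℝ → ℝ} {s γ δ : ℝ}

theorem AdmissibleRadii.hausdorffMeasure_limsupSet_eq_top {φ : ℕ → ℕ} {q : ℕ → ℝ}
    (hq : AdmissibleRadii (ψ ∘ u) (ρ ∘ u) s γ δ φ q) (hβ : ∀ α, 0 < β α)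
    (hl : Tendsto l atTop atTop) (hρ : Tendsto (ρ ∘ u) atTop (𝓝 0))
    (hψ : AntitoneOn ψ (Set.Ioi 0)) (hm : MeasureM2 m δ)
    (hub : IsLocallyUbiquitous m R β ρ l u γ) (hγs : γ < s) (hsδ : s < δ) :
    μH[s] (limsupSet R β ψ) = ∞ := by
  obtain ⟨a, b, r₀, hr₀, hm⟩ := hm.exists_isAhlforsRegular
  obtain ⟨⟨κ, r₁, hκ, hr₁, hubiq⟩, hint⟩ := hub
  have hs : 0 ≤ s := hint.1.trans hγs.le
  obtain ⟨c₁, c₂, hbounds⟩ := exists_eventually_hasIntersectionBounds (l := l) hint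
  obtain ⟨φ, q, hq, hφ⟩ := hq.exists_forall
    (hbounds.and (hρ.eventually_le_const (show 0 < r₀ / 4 by positivity)))
  have hφtop := hq.strictMono.tendsto_atTop
  have hPr₀ : ∀ i, 4 * ρ (u (φ i)) ≤ r₀ := fun i => by
    linarith [show ρ (u (φ i)) ≤ r₀ / 4 from (hφ i).2]
  obtain ⟨ν, hν⟩ := exists_isLevelFamily hm hr₀
    (fun i => (hφ i).1 (q i) (hq.pos i) (hq.le i)) hPr₀ (hρ.comp hφtop)
    (fun i => Set.iUnion_mono fun α => cthickening_subset_thickening'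
      ((hq.pos i).trans (hq.lt i)) (hq.lt i) (R α)) hκ hr₁
    (fun x r hr hrr => (hφtop.eventually (hubiq x r hr hrr)).mono fun i hi => by
      rwa [ubiquityUnion, Set.biUnion_eq_iUnion] at hi) hγs hsδ
  obtain ⟨θ, hθ, hstep⟩ := hq.geometric
  refine measure_mono_top
    (limsup_iUnion_thickening_subset_limsupSet hβ (hl.comp hφtop) hψ)
    (hν.hausdorffMeasure_limsup_eq_top (fun i => isOpen_iUnion fun α => isOpen_thickening)
      hq.pos hθ hstep (fun i => ?_) hq.not_summable hs hsδ)
  have hρi := (hq.pos i).trans_le (hq.le i)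
  exact mul_pos (Real.rpow_pos_of_pos (hq.pos i) _) (Real.rpow_pos_of_pos hρi _)

end LimsupSet

section LimsupG

variable {u : ℕ → ℝ} {ψ ρ : ℝ → ℝ} {s γ δ : ℝ}

theorem exists_admissibleRadii_of_limsupG_eq_zero (hu : Monotone u) (hu₀ : ∀ n, 0 < u n)
    (hutop : Tendsto u atTop atTop) (hψ : IsApproximating ψ) (hρ : IsUbiquityFunction ρ)
    (hγs : γ < s) (hsδ : s < δ) (hG : limsupG ψ ρ u s γ δ = 0)
    (hreg : IsRegular ψ u ∨ IsRegular ρ u)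
    (hdiv : ∑' n, ENNReal.ofReal (gFun ψ ρ s γ δ (u n)) = ∞) :
    ∃ φ q, AdmissibleRadii (ψ ∘ u) (ρ ∘ u) s γ δ φ q := by
  have hψ₀ : ∀ n, 0 < (ψ ∘ u) n := fun n => hψ.1 _ (hu₀ n)
  have hρ₀ : ∀ n, 0 < (ρ ∘ u) n := fun n => hρ.1 _ (hu₀ n)
  have hsum : ¬ Summable fun n => gFun ψ ρ s γ δ (u n) := fun h => h.tsum_ofReal_ne_top hdiv
  have hg : ∀ᶠ n in atTop, gFun ψ ρ s γ δ (u n) ≤ 1 :=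
    (eventually_lt_of_limsup_lt (hG.trans_lt one_pos)).mono fun n hn =>
      (ENNReal.ofReal_lt_one.1 hn).le
  have hle : ∀ᶠ n in atTop, (ψ ∘ u) n ≤ (ρ ∘ u) n := by
    filter_upwards [hg, (hρ.2.comp hutop).eventually_le_const one_pos] with n hgn hρn
    exact le_of_rpow_mul_rpow_le_one (hψ₀ n) (hρ₀ n) hρn hγs hsδ hgn
  rcases hreg with ⟨θ, -, hθ, hstep⟩ | ⟨θ, hθ₀, hθ, hstep⟩
  · exact exists_admissibleRadii_of_subsequence hψ₀ strictMono_id hθ hstep hle hsum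
  · exact exists_admissibleRadii_of_regular hψ₀
      (fun i j hij => hψ.2 (hu₀ i) (hu₀ j) (hu hij)) hρ₀ hγs (hγs.trans hsδ) hle
      (isBoundedUnder_of_eventually_le hg).bddAbove_range hθ₀ hθ hstep hsum

theorem exists_admissibleRadii_of_limsupG_pos (hu₀ : ∀ n, 0 < u n)
    (hutop : Tendsto u atTop atTop) (hψ : ∀ r, 0 < r → 0 < ψ r) (hρ : IsUbiquityFunction ρ)
    (hγs : γ < s) (hsδ : s < δ) (hG : 0 < limsupG ψ ρ u s γ δ) :
    ∃ φ q, AdmissibleRadii (ψ ∘ u) (ρ ∘ u) s γ δ φ q := by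
  obtain ⟨c, hc₀, hc⟩ := ENNReal.lt_iff_exists_nnreal_btwn.1 hG
  have hfreq : ∃ᶠ n in atTop, (c : ℝ) < gFun ψ ρ s γ δ (u n) :=
    (frequently_lt_of_lt_limsup isCobounded_le_of_bot hc).mono fun n hn =>
      (ENNReal.ofReal_lt_ofReal_iff'.1 (by rwa [ENNReal.ofReal_coe_nnreal])).1
  exact exists_admissibleRadii_of_frequently_lt (fun n => hψ _ (hu₀ n)) (fun n => hρ.1 _ (hu₀ n))
    (hρ.2.comp hutop) hγs hsδ (by exact_mod_cast hc₀) hfreq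

end LimsupG

end Ubiquity

open Ubiquity in
theorem corollary4_general {Ω J : Type*} [MetricSpace Ω] [CompactSpace Ω] [MeasurableSpace Ω]
    [BorelSpace Ω] {m : Measure Ω} [IsProbabilityMeasure m] {R : J → Set Ω} {β : J → ℝ}
    (hβ : ∀ α, 0 < β α) {l u : ℕ → ℝ} (hlu : IsLowerUpper l u) {ρ : ℝ → ℝ}
    (hρ : IsUbiquityFunction ρ) {ψ : ℝ → ℝ} (hψ : IsApproximating ψ) {δ γ s : ℝ}
    (hm : MeasureM2 m δ) (hub : IsLocallyUbiquitous m R β ρ l u γ) (hγs : γ < s) (hsδ : s < δ) :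
    (limsupG ψ ρ u s γ δ = 0 → IsRegular ψ u ∨ IsRegular ρ u →
      ∑' n, ENNReal.ofReal (gFun ψ ρ s γ δ (u n)) = ∞ →
      Measure.hausdorffMeasure s (limsupSet R β ψ) = ∞) ∧
    (0 < limsupG ψ ρ u s γ δ → Measure.hausdorffMeasure s (limsupSet R β ψ) = ∞) := by
  have hu₀ : ∀ n, 0 < u n := fun n => (hlu.lower_pos n).trans (hlu.lt n)
  have hutop : Tendsto u atTop atTop := tendsto_atTop_mono (fun n => (hlu.lt n).le) hlu.tendsto
  constructor
  · intro hG hreg hdiv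
    obtain ⟨φ, q, hq⟩ := exists_admissibleRadii_of_limsupG_eq_zero hlu.upper_mono hu₀ hutop hψ hρ
      hγs hsδ hG hreg hdiv
    exact hq.hausdorffMeasure_limsupSet_eq_top hβ hlu.tendsto (hρ.2.comp hutop) hψ.2 hm hub hγs hsδ
  · intro hG
    obtain ⟨φ, q, hq⟩ := exists_admissibleRadii_of_limsupG_pos hu₀ hutop hψ.1 hρ hγs hsδ hG
    exact hq.hausdorffMeasure_limsupSet_eq_top hβ hlu.tendsto (hρ.2.comp hutop) hψ.2 hm hub hγs hsδ

theorem corollary4 {Ω J : Type*} [MetricSpace Ω] [CompactSpace Ω] [MeasurableSpace Ω]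
    [BorelSpace Ω] (m : Measure Ω) [IsProbabilityMeasure m]
    (R : J → Set Ω) (β : J → ℝ) (hβ : Ubiquity.IsWeight β)
    (l u : ℕ → ℝ) (hlu : Ubiquity.IsLowerUpper l u)
    (ρ : ℝ → ℝ) (hρ : Ubiquity.IsUbiquityFunction ρ)
    (ψ : ℝ → ℝ) (hψ : Ubiquity.IsApproximating ψ)
    (δ γ s : ℝ) (hm : Ubiquity.MeasureM2 m δ)
    (hub : Ubiquity.IsLocallyUbiquitous m R β ρ l u γ)
    (hγs : γ < s) (hsδ : s < δ) :
    (Ubiquity.limsupG ψ ρ u s γ δ = 0 →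
      Ubiquity.IsRegular ψ u ∨ Ubiquity.IsRegular ρ u →
      ∑' n, ENNReal.ofReal (Ubiquity.gFun ψ ρ s γ δ (u n)) = ∞ →
      Measure.hausdorffMeasure s (Ubiquity.limsupSet R β ψ) = ∞) ∧
    (0 < Ubiquity.limsupG ψ ρ u s γ δ →
      Measure.hausdorffMeasure s (Ubiquity.limsupSet R β ψ) = ∞) :=
  corollary4_general hβ.1 hlu hρ hψ hm hub hγs hsδ
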